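/- Let $\mathcal X,\mathcal Y$ be finite sets, let $P_X,P_Y$ be probability distributions on $\mathcal X$ and $\mathcal Y$, and let $c:\mathcal X\times\mathcal Y\to[0,\infty)$ be a (finite) cost function. For probability measures $\mu,\nu$ let $C(\mu,\nu)$ be the set of couplings, i.e. of measures on the product space with marginals $\mu$ and $\nu$. Put $$\alpha=\mathcal E(P_X,P_Y):=\inf_{P_{XY}\in C(P_X,P_Y)}\mathbb E\,c(X,Y),$$ and for $n\ge1$ and $a\in\mathbb R$, with the product distributions $P_X^n,P_Y^n$, $$\mathcal G_a(P_X^n,P_Y^n):=\inf_{P_{X^nY^n}\in C(P_X^n,P_Y^n)}\mathbb P\Big\{\frac1n\sum_{i=1}^n c(X_i,Y_i)>a\Big\}.$$ Let $\mathcal S\subseteq\mathcal X\times\mathcal Y$ be the union of the supports of all couplings of $(P_X,P_Y)$ that attain $\mathcal E(P_X,P_Y)$. For $\beta_X\in\mathbb R^{\mathcal X}$ and $\beta_Y\in\mathbb R^{\mathcal Y}$ let $$\theta(\beta_X,\beta_Y):=\inf\sum_{x,y}\beta(x,y)c(x,y),$$ where the infimum is over all real tables $\beta\in\mathbb R^{\mathcal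 X\times\mathcal Y}$ with $\sum_y\beta(x,y)=\beta_X(x)$ for all $x$, $\sum_x\beta(x,y)=\beta_Y(y)$ for all $y$, and $\{(x,y):\beta(x,y)<0\}\subseteq\mathcal S$ (and $\inf\emptyset=+\infty$). Let $\Phi_{P_X}$ be the centred Gaussian measure on $\mathbb R^{\mathcal X}$ with covariance matrix $\big[P_X(x)1\{x=x'\}-P_X(x)P_X(x')\big]_{x,x'\in\mathcal X}$, define $\Phi_{P_Y}$ similarly, and for $\Delta\in\mathbb R$ let $$\Lambda_\Delta(P_X,P_Y):=\inf_{\Psi\in C(\Phi_{P_X},\Phi_{P_Y})}\Psi\{(\beta_X,\beta_Y):\theta(\beta_X,\beta_Y)>\Delta\}.$$ Then the following hold. 1. For every $\Delta\in\mathbb R$ the limit $\lim_{\Delta'\uparrow\Delta}\Lambda_{\Delta'}(P_X,P_Y)$ exists, and $$\Lambda_\Delta(P_X,P_Y)\le\liminf_{n\to\infty}\mathcal G_{\alpha+\frac{\Delta}{\sqrt n}}(P_X^n,P_Y^n)\le\limsup_{n\to\infty}\mathcal G_{\alpha+\frac{\Delta}{\sqrt n}}(P_X^n,P_Y^n)\le\lim_{\Delta'\uparrow\Delta}\Lambda_{\Delta'}(P_X,P_Y).$$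 2. The function $\Delta\mapsto\Lambda_\Delta(P_X,P_Y)$ is right-continuous on $\mathbb R$. 3. For Lebesgue-almost every $\Delta\in\mathbb R$, $\displaystyle\lim_{n\to\infty}\mathcal G_{\alpha+\frac{\Delta}{\sqrt n}}(P_X^n,P_Y^n)=\Lambda_\Delta(P_X,P_Y)$. -/

import Mathlib

open MeasureTheory ProbabilityTheory Filter Topology
open scoped NNReal ENNReal

namespace StrassenOT

noncomputable section

/-- The coupling set `C(μ, ν)`: all measures on the product with marginals `μ` and `ν`. -/
def couplings {A B : Type*} [MeasurableSpace A] [MeasurableSpace B]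
    (μ : Measure A) (ν : Measure B) : Set (Measure (A × B)) :=
  {π | π.map Prod.fst = μ ∧ π.map Prod.snd = ν}

/-- The Monge-Kantorovich optimal transport cost `inf_{π ∈ C(μ, ν)} 𝔼_π c(X, Y)`. -/
def otCost {A B : Type*} [MeasurableSpace A] [MeasurableSpace B]
    (c : A → B → ℝ≥0) (μ : Measure A) (ν : Measure B) : ℝ≥0∞ :=
  ⨅ π ∈ couplings μ ν, ∫⁻ z, (c z.1 z.2 : ℝ≥0∞) ∂π

/-- Strassen's optimal transport problem, the optimal excess-cost probability
`inf_{π ∈ C(μ, ν)} π {c > a}`, for a cost with values in the extended reals. -/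
def excessProb {A B : Type*} [MeasurableSpace A] [MeasurableSpace B]
    (c : A → B → EReal) (a : ℝ) (μ : Measure A) (ν : Measure B) : ℝ≥0∞ :=
  ⨅ π ∈ couplings μ ν, π {z | (a : EReal) < c z.1 z.2}

/-- The additive cost `c_n(xⁿ, yⁿ) = (1/n) ∑ c(x_i, y_i)`. -/
def avgCost {A B : Type*} (c : A → B → ℝ≥0) (n : ℕ) (x : Fin n → A) (y : Fin n → B) : ℝ :=
  (∑ i, (c (x i) (y i) : ℝ)) / n

/-- `G_a(μⁿ, νⁿ)`: Strassen's problem for the product laws `μⁿ`, `νⁿ` with the cost `c_n`. -/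
def productExcessProb {A B : Type*} [MeasurableSpace A] [MeasurableSpace B]
    (c : A → B → ℝ≥0) (n : ℕ) (a : ℝ) (μ : Measure A) (ν : Measure B) : ℝ≥0∞ :=
  excessProb (fun x y => (avgCost c n x y : EReal)) a
    (Measure.pi fun _ : Fin n => μ) (Measure.pi fun _ : Fin n => ν)

/-- The union of the supports of all couplings that attain the optimal transport cost
(for measures on finite alphabets, where the support is the set of atoms). -/
def optSupport {A B : Type*} [MeasurableSpace A] [MeasurableSpace B]
    (c : A → B → ℝ≥0) (μ : Measure A) (ν : Measure B) : Set (A × B) :=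
  {z | ∃ π ∈ couplings μ ν,
    ∫⁻ w, (c w.1 w.2 : ℝ≥0∞) ∂π = otCost c μ ν ∧ π {z} ≠ 0}

/-- The signed tables with marginals `βX`, `βY` that are negative only on `S`. -/
def signedCouplings {A B : Type*} [Fintype A] [Fintype B]
    (S : Set (A × B)) (βX : A → ℝ) (βY : B → ℝ) : Set (A → B → ℝ) :=
  {β | (∀ x, ∑ y, β x y = βX x) ∧ (∀ y, ∑ x, β x y = βY y) ∧
    ∀ x y, β x y < 0 → (x, y) ∈ S}

/-- The cost `θ(βX, βY)`: the least value of `∑ β(x, y) c(x, y)` over the signed couplings of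
`βX` and `βY` that are negative only on the union of the supports of the optimal couplings
(`+∞` if there are none). -/
def theta {A B : Type*} [Fintype A] [Fintype B] [MeasurableSpace A] [MeasurableSpace B]
    (c : A → B → ℝ≥0) (μ : Measure A) (ν : Measure B) (βX : A → ℝ) (βY : B → ℝ) : EReal :=
  ⨅ β ∈ signedCouplings (optSupport c μ ν) βX βY,
    ((∑ x, ∑ y, β x y * (c x y : ℝ) : ℝ) : EReal)

/-- The covariance matrix `P(x) 1{x = x'} - P(x) P(x')` of the indicator vector
`(1{X = x})_x`, where `X ∼ P`. -/
def indicatorCov {A : Type*} [DecidableEq A] [MeasurableSpace A] (P : Measure A) :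
    Matrix A A ℝ :=
  Matrix.of fun x x' => (if x = x' then P.real {x} else 0) - P.real {x} * P.real {x'}

/-- `indicatorCov P` is a genuine covariance matrix. -/
theorem indicatorCov_posSemidef {A : Type*} [Fintype A] [DecidableEq A] [MeasurableSpace A]
    [MeasurableSingletonClass A] (P : Measure A) [IsProbabilityMeasure P] :
    (indicatorCov P).PosSemidef := by
  have hsum : ∑ x, P.real {x} = 1 := by
    rw [sum_measureReal_singleton]
    simp
  refine Matrix.PosSemidef.of_dotProduct_mulVec_nonneg ?_ fun v => ?_
  · ext x x'
    simp only [indicatorCov, Matrix.conjTranspose_apply, Matrix.of_apply, star_trivial]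
    by_cases h : x = x'
    · subst h; rfl
    · simp [h, Ne.symm h, mul_comm]
  · have h1 : star v ⬝ᵥ (indicatorCov P).mulVec v
        = ∑ x, P.real {x} * (v x - ∑ x', P.real {x'} * v x') ^ 2 := by
      set m := ∑ x', P.real {x'} * v x' with hm
      have h2 : ∑ x, P.real {x} * (v x - m) ^ 2 = ∑ x, P.real {x} * v x ^ 2 - m ^ 2 := by
        have : ∀ x, P.real {x} * (v x - m) ^ 2
            = P.real {x} * v x ^ 2 - 2 * m * (P.real {x} * v x) + m ^ 2 * P.real {x} := by
          intro x; ring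
        simp only [this, Finset.sum_add_distrib, Finset.sum_sub_distrib, ← Finset.mul_sum,
          hsum, ← hm]
        ring
      rw [h2]
      have h3 : ∀ x, (indicatorCov P).mulVec v x = P.real {x} * v x - P.real {x} * m := by
        intro x
        simp only [indicatorCov, Matrix.mulVec, dotProduct, Matrix.of_apply, sub_mul, ite_mul,
          zero_mul, Finset.sum_sub_distrib, Finset.sum_ite_eq, Finset.mem_univ, if_true, mul_assoc,
          ← Finset.mul_sum, ← hm]
      simp only [dotProduct, h3, star_trivial, mul_sub, Finset.sum_sub_distrib]
      have h4 : ∑ x, v x * (P.real {x} * m) = m ^ 2 := by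
        have : ∀ x, v x * (P.real {x} * m) = m * (P.real {x} * v x) := by intro x; ring
        simp only [this, ← Finset.mul_sum, ← hm]
        ring
      rw [h4]
      congr 1
      exact Finset.sum_congr rfl fun x _ => by ring
    rw [h1]
    exact Finset.sum_nonneg fun x _ => mul_nonneg measureReal_nonneg (sq_nonneg _)

/-- The centred Gaussian law `Φ_P` with the covariance matrix of the indicator vector. -/
def gaussLaw {A : Type*} [Fintype A] [DecidableEq A] [MeasurableSpace A] (P : Measure A) :
    Measure (EuclideanSpace ℝ A) :=
  multivariateGaussian 0 (indicatorCov P)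

/-- `Λ_Δ(P_X, P_Y)`: Strassen's problem between the Gaussian laws, with the cost `θ`. -/
def Lam {A B : Type*} [Fintype A] [DecidableEq A] [MeasurableSpace A]
    [Fintype B] [DecidableEq B] [MeasurableSpace B]
    (c : A → B → ℝ≥0) (μ : Measure A) (ν : Measure B) (Δ : ℝ) : ℝ≥0∞ :=
  excessProb (fun (βX : EuclideanSpace ℝ A) (βY : EuclideanSpace ℝ B) =>
    theta c μ ν (fun x => βX x) (fun y => βY y)) Δ (gaussLaw μ) (gaussLaw ν)

end

end StrassenOT

/-! Any coupling of the product laws can be improved by rearranging `y` optimally against `x` and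
then shuffling both sequences by a common uniform permutation. By Birkhoff's theorem the best
rearrangement costs at most any coupling of the two empirical distributions. These are `p + b_X/√n`
and `q + b_Y/√n`, where `b_X` and `b_Y` are asymptotically Gaussian by the central limit theorem.
The optimal cost between them is `α + θ(b_X, b_Y)/√n` to first order: the tables that are negative
only on `𝒮` form the tangent cone of the transport polytope at an optimal table `Q` of maximal
support. So the excess event becomes `θ > Δ`.

Lower bound. If `E` is the joint empirical table of `(x, y)`, then `√n (E - Q)` is a signed coupling
of the fluctuations, whence `θ ≤ √n (c_n - α)` for every `n > 0`
(`exists_signedCoupling_fluctuation`). A Hoffman-type bound keeps near-minimizers bounded, so `θ` is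
lower semicontinuous and `{θ > Δ}` is open. Couplings of weakly convergent laws have convergent
subsequences, and the portmanteau theorem passes to the limit (`iInf_couplings_le_liminf`). With
constant laws and the increasing sets `{θ > Δ + 1/(k+1)}` the same argument gives right-continuity.

Upper bound. Fix a Gaussian coupling `Ψ` and `Δ' < Δ`. Both spaces are cut into finitely many cells
with null boundaries, all but one of them small and bounded. The masses that `Ψ` gives to pairs of
cells are transferred to a coupling of the sequences at the expense of vanishing deficits
(`exists_table_of_index_maps`, `tendsto_deficit`). The least signed cost is Lipschitz on admissible
perturbations, so one admissible pair with `θ ≤ Δ'` in a small cell forces `θ ≤ Δ` at all admissible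
fluctuations in that cell. For large `n` the table `Q + β/√n` is then nonnegative, and Birkhoff's
theorem supplies the matching (`eventually_exists_perm_avgCost_le`).

Finally, `Λ` is antitone, so the two bounds agree off a countable set. -/

namespace StrassenOT

/-! ### Carathéodory reduction and a Hoffman bound -/

section LinearProgramming

variable {ι E : Type*} [Fintype ι] [NormedAddCommGroup E] [NormedSpace ℝ E]

/-- Carathéodory reduction: a nonnegative combination can be replaced, without raising its cost, by
one that uses linearly independent vectors only. -/
theorem exists_linearIndependent_nonneg_combination (V : ι → E) (w : ι → ℝ)
    (hw : ∀ m : ι → ℝ, (∀ i, 0 ≤ m i) → ∑ i, m i • V i = 0 → 0 ≤ ∑ i, m i * w i)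
    (l : ι → ℝ) (hl : ∀ i, 0 ≤ l i) :
    ∃ l' : ι → ℝ, (∀ i, 0 ≤ l' i) ∧ ∑ i, l' i • V i = ∑ i, l i • V i ∧
      ∑ i, l' i * w i ≤ ∑ i, l i * w i ∧
      LinearIndependent ℝ (fun i : {i // l' i ≠ 0} => V i) := by
  classical
  induction hk : (Finset.univ.filter fun i => l i ≠ 0).card using Nat.strong_induction_on
    generalizing l with
  | _ k ih =>
  by_cases hli : LinearIndependent ℝ (fun i : {i // l i ≠ 0} => V i)
  · exact ⟨l, hl, rfl, le_rfl, hli⟩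
  -- a nontrivial relation, extended by zero
  obtain ⟨m, hm0, hmV, i₁, hi₁⟩ : ∃ m : ι → ℝ, (∀ i, l i = 0 → m i = 0) ∧
      ∑ i, m i • V i = 0 ∧ ∃ i, m i ≠ 0 := by
    rw [Fintype.not_linearIndependent_iff] at hli
    obtain ⟨g, hg, i, hi⟩ := hli
    refine ⟨fun i => if h : l i ≠ 0 then g ⟨i, h⟩ else 0, fun i h => by simp [h], ?_, i, ?_⟩
    · have h1 := Finset.sum_subtype (F := inferInstance) (Finset.univ.filter fun i => l i ≠ 0)
        (p := fun i => l i ≠ 0) (by simp)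
        (fun i => (if h : l i ≠ 0 then g ⟨i, h⟩ else 0) • V i)
      rw [Finset.sum_filter] at h1
      have h2 : ∀ i : {i // l i ≠ 0}, (if h : l i ≠ 0 then g ⟨i, h⟩ else 0) • V i = g i • V i :=
        fun i => by rw [dif_pos i.2]
      simp only [h2, hg] at h1
      rw [← h1]
      refine Finset.sum_congr rfl fun i _ => ?_
      by_cases h : l i = 0 <;> simp [h]
    · simpa [i.2] using hi
  -- choose the sign so that the cost does not grow and some entry is negative
  obtain ⟨m, hm0, hmV, hmw, i₁, hi₁⟩ : ∃ m : ι → ℝ, (∀ i, l i = 0 → m i = 0) ∧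
      ∑ i, m i • V i = 0 ∧ ∑ i, m i * w i ≤ 0 ∧ ∃ i, m i < 0 := by
    have key : ∀ m : ι → ℝ, (∀ i, l i = 0 → m i = 0) → ∑ i, m i • V i = 0 →
        (∃ i, m i ≠ 0) → ∑ i, m i * w i ≤ 0 → ∃ m : ι → ℝ, (∀ i, l i = 0 → m i = 0) ∧
        ∑ i, m i • V i = 0 ∧ ∑ i, m i * w i ≤ 0 ∧ ∃ i, m i < 0 := by
      intro m h0 hV ⟨i, hi⟩ hc
      by_cases hneg : ∃ i, m i < 0
      · exact ⟨m, h0, hV, hc, hneg⟩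
      push Not at hneg
      -- Here `m` is a recession direction, so its cost is also nonnegative, hence zero, and the
      -- sign can be reversed for free.
      have := hw m hneg hV
      refine ⟨fun i => - m i, fun i h => by simp [h0 i h], by simp [hV], ?_, i, ?_⟩
      · simp only [neg_mul, Finset.sum_neg_distrib]; linarith
      · have := lt_of_le_of_ne (hneg i) (Ne.symm hi); linarith
    by_cases hc : ∑ i, m i * w i ≤ 0
    · exact key m hm0 hmV ⟨i₁, hi₁⟩ hc
    · refine key (fun i => - m i) (fun i h => by simp [hm0 i h]) (by simp [hmV])
        ⟨i₁, by simpa using hi₁⟩ ?_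
      simp only [neg_mul, Finset.sum_neg_distrib]; linarith
  -- Ratio test: `t` is the longest step along `m` that keeps all coefficients nonnegative, and it
  -- annihilates the coefficient `j`.
  obtain ⟨j, hj, hjmin⟩ := Finset.exists_min_image (Finset.univ.filter fun i => m i < 0)
    (fun i => l i / (- m i)) ⟨i₁, by simpa using hi₁⟩
  simp only [Finset.mem_filter, Finset.mem_univ, true_and] at hj hjmin
  set t := l j / (- m j) with ht
  have ht0 : 0 ≤ t := div_nonneg (hl j) (by linarith)
  have hl' : ∀ i, 0 ≤ l i + t * m i := by
    intro i
    by_cases hi : m i < 0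
    · have := hjmin i hi
      rw [le_div_iff₀ (by linarith)] at this
      linarith
    · have := mul_nonneg ht0 (not_lt.1 hi); linarith [hl i]
  have hsub : (Finset.univ.filter fun i => l i + t * m i ≠ 0) ⊂
      (Finset.univ.filter fun i => l i ≠ 0) := by
    refine Finset.ssubset_iff_subset_ne.2 ⟨fun i => ?_, fun h => ?_⟩
    · simp only [Finset.mem_filter, Finset.mem_univ, true_and]
      intro h h'
      exact h (by simp [h', hm0 i h'])
    · have h1 : j ∈ (Finset.univ.filter fun i => l i ≠ 0) := by
        simp only [Finset.mem_filter, Finset.mem_univ, true_and]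
        intro h'
        have := hm0 j h'
        linarith
      rw [← h] at h1
      simp only [Finset.mem_filter, Finset.mem_univ, true_and] at h1
      apply h1
      rw [ht]
      have : m j ≠ 0 := hj.ne
      field_simp
      ring
  obtain ⟨l', h1, h2, h3, h4⟩ := ih _ (hk ▸ Finset.card_lt_card hsub) _ hl' rfl
  refine ⟨l', h1, ?_, h3.trans ?_, h4⟩
  · rw [h2]
    simp only [add_smul, Finset.sum_add_distrib, mul_smul, ← Finset.smul_sum, hmV, smul_zero,
      add_zero]
  · simp only [add_mul, Finset.sum_add_distrib, mul_assoc, ← Finset.mul_sum]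
    nlinarith

/-- A Hoffman-type bound: if no recession direction has negative cost, then every feasible point can
be replaced by one of no larger cost whose size is controlled by the right-hand side. -/
theorem exists_bounded_nonneg_combination (V : ι → E) (w : ι → ℝ)
    (hw : ∀ m : ι → ℝ, (∀ i, 0 ≤ m i) → ∑ i, m i • V i = 0 → 0 ≤ ∑ i, m i * w i) :
    ∃ K : ℝ, 0 ≤ K ∧ ∀ l : ι → ℝ, (∀ i, 0 ≤ l i) →
      ∃ l' : ι → ℝ, (∀ i, 0 ≤ l' i) ∧ ∑ i, l' i • V i = ∑ i, l i • V i ∧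
        ∑ i, l' i * w i ≤ ∑ i, l i * w i ∧ ∀ i, l' i ≤ K * ‖∑ i, l i • V i‖ := by
  classical
  -- On independent vectors the coefficients are controlled by the combination. There are finitely
  -- many index sets, so the sum of their constants serves them all.
  have key : ∀ s : Finset ι, ∃ K : ℝ, 0 ≤ K ∧ (LinearIndependent ℝ (fun i : s => V i) →
      ∀ l : ι → ℝ, (∀ i, i ∉ s → l i = 0) → ∀ i, l i ≤ K * ‖∑ i, l i • V i‖) := by
    intro s
    by_cases hs : LinearIndependent ℝ (fun i : s => V i)
    swap
    · exact ⟨0, le_rfl, fun h => absurd h hs⟩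
    have hker : LinearMap.ker (Fintype.linearCombination ℝ (fun i : s => V i)) = ⊥ :=
      LinearMap.ker_eq_bot'.2 fun g hg => funext (Fintype.linearIndependent_iff.1 hs g hg)
    obtain ⟨K, -, hK⟩ := (Fintype.linearCombination ℝ (fun i : s => V i)).exists_antilipschitzWith
      hker
    refine ⟨K, K.2, fun _ l hl i => ?_⟩
    have h1 : ∑ i, l i • V i = Fintype.linearCombination ℝ (fun i : s => V i) (fun i => l i) := by
      rw [Fintype.linearCombination_apply, Finset.sum_coe_sort s (fun i => l i • V i)]
      refine (Finset.sum_subset (Finset.subset_univ s) fun i _ hi => by simp [hl i hi]).symm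
    have h2 := hK.le_mul_dist (fun i : s => l i) 0
    rw [dist_zero_right, map_zero, dist_zero_right, ← h1] at h2
    by_cases hi : i ∈ s
    · exact (le_abs_self _).trans ((norm_le_pi_norm (fun i : s => l i) ⟨i, hi⟩).trans h2)
    · rw [hl i hi]; exact mul_nonneg K.2 (norm_nonneg _)
  choose K hK0 hK using key
  refine ⟨∑ s, K s, Finset.sum_nonneg fun s _ => hK0 s, fun l hl => ?_⟩
  obtain ⟨l', h1, h2, h3, h4⟩ := exists_linearIndependent_nonneg_combination V w hw l hl
  refine ⟨l', h1, h2, h3, fun i => ?_⟩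
  set s := Finset.univ.filter fun i => l' i ≠ 0 with hs
  have hsi : LinearIndependent ℝ (fun i : s => V i) := by
    have := h4.comp (fun i : s => (⟨i.1, (Finset.mem_filter.1 i.2).2⟩ : {i // l' i ≠ 0}))
      (fun a b h => Subtype.ext (Subtype.mk.inj h))
    exact this
  refine (hK s hsi l' (fun i hi => by simpa [hs] using hi) i).trans ?_
  rw [h2]
  exact mul_le_mul_of_nonneg_right
    (Finset.single_le_sum (fun s _ => hK0 s) (Finset.mem_univ s)) (norm_nonneg _)

end LinearProgramming

/-! ### Transport tables and optimal couplings on finite alphabets -/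

section Tables

variable {A B : Type*} [Fintype A] [Fintype B]

/-- The nonnegative tables with row sums `p` and column sums `q`. -/
def tables (p : A → ℝ) (q : B → ℝ) : Set (A → B → ℝ) :=
  {R | (∀ x y, 0 ≤ R x y) ∧ (∀ x, ∑ y, R x y = p x) ∧ ∀ y, ∑ x, R x y = q y}

/-- The total cost of a table. -/
def tableCost (c : A → B → ℝ≥0) (R : A → B → ℝ) : ℝ := ∑ x, ∑ y, R x y * (c x y : ℝ)

theorem continuous_tableCost (c : A → B → ℝ≥0) : Continuous (tableCost c) := by
  unfold tableCost
  fun_prop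

theorem tableCost_add (c : A → B → ℝ≥0) (R R' : A → B → ℝ) :
    tableCost c (R + R') = tableCost c R + tableCost c R' := by
  simp [tableCost, add_mul, Finset.sum_add_distrib]

theorem tableCost_smul (c : A → B → ℝ≥0) (t : ℝ) (R : A → B → ℝ) :
    tableCost c (t • R) = t * tableCost c R := by
  simp [tableCost, Finset.mul_sum, mul_assoc]

theorem tableCost_sub (c : A → B → ℝ≥0) (R R' : A → B → ℝ) :
    tableCost c (R - R') = tableCost c R - tableCost c R' := by
  simp [tableCost, sub_mul, Finset.sum_sub_distrib]

theorem tableCost_nonneg (c : A → B → ℝ≥0) {R : A → B → ℝ} (hR : ∀ x y, 0 ≤ R x y) :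
    0 ≤ tableCost c R :=
  Finset.sum_nonneg fun x _ => Finset.sum_nonneg fun y _ => mul_nonneg (hR x y) (c x y).2

theorem isCompact_tables (p : A → ℝ) (q : B → ℝ) : IsCompact (tables p q) := by
  refine Metric.isCompact_of_isClosed_isBounded ?_ ?_
  · have : tables p q = (⋂ x, ⋂ y, {R | 0 ≤ R x y}) ∩ ((⋂ x, {R | ∑ y, R x y = p x}) ∩
        ⋂ y, {R | ∑ x, R x y = q y}) := by
      ext R; simp [tables]
    rw [this]
    refine IsClosed.inter ?_ (IsClosed.inter ?_ ?_)
    · exact isClosed_iInter fun x => isClosed_iInter fun y =>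
        isClosed_le continuous_const (by fun_prop)
    · exact isClosed_iInter fun x => isClosed_eq (by fun_prop) continuous_const
    · exact isClosed_iInter fun x => isClosed_eq (by fun_prop) continuous_const
  · refine (Metric.isBounded_Icc (0 : A → B → ℝ) (fun x _ => p x)).subset ?_
    intro R hR
    refine ⟨fun x y => hR.1 x y, fun x y => ?_⟩
    refine le_of_le_of_eq ?_ (hR.2.1 x)
    exact Finset.single_le_sum (f := fun y => R x y) (fun y _ => hR.1 x y) (Finset.mem_univ y)

theorem mul_mem_tables {p : A → ℝ} {q : B → ℝ} (hp : ∀ x, 0 ≤ p x) (hq : ∀ y, 0 ≤ q y)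
    (hp1 : ∑ x, p x = 1) (hq1 : ∑ y, q y = 1) : (fun x y => p x * q y) ∈ tables p q :=
  ⟨fun x y => mul_nonneg (hp x) (hq y), fun x => by rw [← Finset.mul_sum, hq1, mul_one],
    fun y => by rw [← Finset.sum_mul, hp1, one_mul]⟩

variable [MeasurableSpace A] [MeasurableSingletonClass A]
  [MeasurableSpace B] [MeasurableSingletonClass B]

/-- The measure with the given table of point masses. -/
noncomputable def tableMeasure (R : A → B → ℝ) : Measure (A × B) :=
  ∑ z, ENNReal.ofReal (R z.1 z.2) • Measure.dirac z

theorem tableMeasure_apply (R : A → B → ℝ) (s : Set (A × B)) [DecidablePred (· ∈ s)] :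
    tableMeasure R s = ∑ z, if z ∈ s then ENNReal.ofReal (R z.1 z.2) else 0 := by
  classical
  have hs : MeasurableSet s := s.toFinite.measurableSet
  simp only [tableMeasure, Measure.finsetSum_apply, Measure.smul_apply,
    Measure.dirac_apply' _ hs, smul_eq_mul, Set.indicator_apply, Pi.one_apply, mul_ite, mul_one,
    mul_zero]

theorem tableMeasure_singleton (R : A → B → ℝ) (z : A × B) :
    tableMeasure R {z} = ENNReal.ofReal (R z.1 z.2) := by
  classical
  rw [tableMeasure_apply]
  simp

theorem tableMeasure_mem_couplings {μ : Measure A} {ν : Measure B} [IsFiniteMeasure μ]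
    [IsFiniteMeasure ν] {R : A → B → ℝ}
    (hR : R ∈ tables (fun x => μ.real {x}) (fun y => ν.real {y})) :
    tableMeasure R ∈ couplings μ ν := by
  classical
  constructor
  · refine Measure.ext_of_singleton fun x => ?_
    rw [Measure.map_apply measurable_fst (measurableSet_singleton x), tableMeasure_apply,
      Fintype.sum_prod_type]
    have h : ∀ x', ∑ y, (if ((x', y) : A × B) ∈ Prod.fst ⁻¹' {x} then
        ENNReal.ofReal (R x' y) else 0) = if x' = x then ENNReal.ofReal (μ.real {x}) else 0 := by
      intro x'
      by_cases hx : x' = x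
      · subst hx
        simp only [Set.mem_preimage, Set.mem_singleton_iff, if_true]
        rw [← ENNReal.ofReal_sum_of_nonneg fun y _ => hR.1 _ _, hR.2.1]
      · simp [hx]
    simp only [h, Finset.sum_ite_eq', Finset.mem_univ, if_true]
    rw [ofReal_measureReal]
  · refine Measure.ext_of_singleton fun y => ?_
    rw [Measure.map_apply measurable_snd (measurableSet_singleton y), tableMeasure_apply,
      Fintype.sum_prod_type_right]
    have h : ∀ y', ∑ x, (if ((x, y') : A × B) ∈ Prod.snd ⁻¹' {y} then
        ENNReal.ofReal (R x y') else 0) = if y' = y then ENNReal.ofReal (ν.real {y}) else 0 := by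
      intro y'
      by_cases hy : y' = y
      · subst hy
        simp only [Set.mem_preimage, Set.mem_singleton_iff, if_true]
        rw [← ENNReal.ofReal_sum_of_nonneg fun y _ => hR.1 _ _, hR.2.2]
      · simp [hy]
    simp only [h, Finset.sum_ite_eq', Finset.mem_univ, if_true]
    rw [ofReal_measureReal]

theorem isProbabilityMeasure_of_mem_couplings {E F : Type*} [MeasurableSpace E] [MeasurableSpace F]
    {μ : Measure E} {ν : Measure F} [IsProbabilityMeasure μ] {π : Measure (E × F)}
    (hπ : π ∈ couplings μ ν) : IsProbabilityMeasure π := by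
  constructor
  rw [← Set.preimage_univ (f := (Prod.fst : E × F → E)), ← Measure.map_apply measurable_fst .univ,
    hπ.1, measure_univ]

theorem couplings_real_mem_tables {μ : Measure A} {ν : Measure B} [IsProbabilityMeasure μ]
    {π : Measure (A × B)} (hπ : π ∈ couplings μ ν) :
    (fun x y => π.real {(x, y)}) ∈ tables (fun x => μ.real {x}) (fun y => ν.real {y}) := by
  classical
  have := isProbabilityMeasure_of_mem_couplings hπ
  refine ⟨fun x y => measureReal_nonneg, fun x => ?_, fun y => ?_⟩
  · show _ = μ.real {x}
    rw [← hπ.1, map_measureReal_apply measurable_fst (measurableSet_singleton x)]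
    have : (Prod.fst : A × B → A) ⁻¹' {x} = ↑(Finset.univ.image fun y : B => (x, y)) := by
      ext ⟨a, b⟩; simp [eq_comm]
    rw [this, ← sum_measureReal_singleton, Finset.sum_image (by intro a _ b _ h; simpa using h)]
  · show _ = ν.real {y}
    rw [← hπ.2, map_measureReal_apply measurable_snd (measurableSet_singleton y)]
    have : (Prod.snd : A × B → B) ⁻¹' {y} = ↑(Finset.univ.image fun x : A => (x, y)) := by
      ext ⟨a, b⟩; simp [eq_comm]
    rw [this, ← sum_measureReal_singleton, Finset.sum_image (by intro a _ b _ h; simpa using h)]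

theorem lintegral_cost_eq (c : A → B → ℝ≥0) (π : Measure (A × B)) [IsFiniteMeasure π] :
    ∫⁻ z, (c z.1 z.2 : ℝ≥0∞) ∂π = ENNReal.ofReal (tableCost c fun x y => π.real {(x, y)}) := by
  rw [lintegral_fintype, tableCost, ← Fintype.sum_prod_type' (fun x y => π.real {(x, y)} * (c x y : ℝ)),
    ENNReal.ofReal_sum_of_nonneg fun z _ => by positivity]
  refine Finset.sum_congr rfl fun z _ => ?_
  rw [ENNReal.ofReal_mul measureReal_nonneg, ofReal_measureReal, mul_comm, ENNReal.ofReal_coe_nnreal]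

theorem exists_isMinOn_tableCost (c : A → B → ℝ≥0) (μ : Measure A) (ν : Measure B)
    [IsProbabilityMeasure μ] [IsProbabilityMeasure ν] :
    ∃ Q ∈ tables (fun x => μ.real {x}) (fun y => ν.real {y}),
      (∀ R ∈ tables (fun x => μ.real {x}) (fun y => ν.real {y}),
        tableCost c Q ≤ tableCost c R) ∧ otCost c μ ν = ENNReal.ofReal (tableCost c Q) := by
  have h1 : ∑ x, μ.real {x} = 1 := by rw [sum_measureReal_singleton]; simp
  have h2 : ∑ x, ν.real {x} = 1 := by rw [sum_measureReal_singleton]; simp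
  obtain ⟨Q, hQ, hmin⟩ := (isCompact_tables (fun x => μ.real {x}) (fun y => ν.real {y})).exists_isMinOn
    ⟨_, mul_mem_tables (fun _ => measureReal_nonneg) (fun _ => measureReal_nonneg) h1 h2⟩
    (continuous_tableCost c).continuousOn
  refine ⟨Q, hQ, fun R hR => hmin hR, le_antisymm ?_ ?_⟩
  · have hc := tableMeasure_mem_couplings hQ
    have := isProbabilityMeasure_of_mem_couplings hc
    refine (iInf₂_le _ hc).trans ?_
    rw [lintegral_cost_eq]
    simp only [measureReal_def, tableMeasure_singleton, ENNReal.toReal_ofReal (hQ.1 _ _), le_refl]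
  · refine le_iInf₂ fun π hπ => ?_
    have := isProbabilityMeasure_of_mem_couplings hπ
    rw [lintegral_cost_eq]
    exact ENNReal.ofReal_le_ofReal (hmin (couplings_real_mem_tables hπ))

/-- An optimal table whose set of positive entries is the union of the supports of all optimal
couplings. -/
theorem exists_optimal_table (c : A → B → ℝ≥0) (μ : Measure A) (ν : Measure B)
    [IsProbabilityMeasure μ] [IsProbabilityMeasure ν] :
    ∃ Q ∈ tables (fun x => μ.real {x}) (fun y => ν.real {y}),
      (∀ R ∈ tables (fun x => μ.real {x}) (fun y => ν.real {y}),
        tableCost c Q ≤ tableCost c R) ∧ (otCost c μ ν).toReal = tableCost c Q ∧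
      ∀ x y, 0 < Q x y ↔ (x, y) ∈ optSupport c μ ν := by
  classical
  obtain ⟨Q₀, hQ₀, hmin, hot⟩ := exists_isMinOn_tableCost c μ ν
  have hcost : ∀ π ∈ couplings μ ν, ∫⁻ w, (c w.1 w.2 : ℝ≥0∞) ∂π = otCost c μ ν →
      tableCost c (fun x y => π.real {(x, y)}) = tableCost c Q₀ := by
    intro π hπ h
    have := isProbabilityMeasure_of_mem_couplings hπ
    rw [lintegral_cost_eq, hot] at h
    exact (ENNReal.ofReal_eq_ofReal_iff (tableCost_nonneg c (couplings_real_mem_tables hπ).1)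
      (tableCost_nonneg c hQ₀.1)).1 h
  have hopt : ∀ R ∈ tables (fun x => μ.real {x}) (fun y => ν.real {y}),
      tableCost c R = tableCost c Q₀ → ∀ x y, 0 < R x y → (x, y) ∈ optSupport c μ ν := by
    intro R hR h x y hxy
    have hc := tableMeasure_mem_couplings hR
    have := isProbabilityMeasure_of_mem_couplings hc
    refine ⟨_, hc, ?_, ?_⟩
    · rw [lintegral_cost_eq, hot, ← h]
      simp only [measureReal_def, tableMeasure_singleton, ENNReal.toReal_ofReal (hR.1 _ _)]
    · rw [tableMeasure_singleton]
      simpa using hxy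
  -- One optimal table per cell, positive there if the cell lies in `optSupport`. By convexity their
  -- average is optimal, and it is positive on all these cells at once.
  have hex : ∀ z : A × B, ∃ R ∈ tables (fun x => μ.real {x}) (fun y => ν.real {y}),
      tableCost c R = tableCost c Q₀ ∧ (z ∈ optSupport c μ ν → 0 < R z.1 z.2) := by
    intro z
    by_cases hz : z ∈ optSupport c μ ν
    · obtain ⟨π, hπ, h1, h2⟩ := hz
      have := isProbabilityMeasure_of_mem_couplings hπ
      refine ⟨_, couplings_real_mem_tables hπ, hcost π hπ h1, fun _ => ?_⟩
      exact ENNReal.toReal_pos h2 (measure_ne_top _ _)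
    · exact ⟨Q₀, hQ₀, rfl, fun h => absurd h hz⟩
  choose R hR hRc hRp using hex
  have : Nonempty (A × B) := by
    have ha : (Set.univ : Set A).Nonempty := nonempty_of_measure_ne_zero (μ := μ) (by simp)
    have hb : (Set.univ : Set B).Nonempty := nonempty_of_measure_ne_zero (μ := ν) (by simp)
    exact ⟨ha.some, hb.some⟩
  set N : ℝ := (Fintype.card (A × B) : ℝ) with hN
  have hNpos : 0 < N := by rw [hN]; exact_mod_cast Fintype.card_pos
  have hQ : (N⁻¹ • ∑ z, R z) ∈ tables (fun x => μ.real {x}) (fun y => ν.real {y}) := by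
    refine ⟨fun x y => ?_, fun x => ?_, fun y => ?_⟩
    · simp only [Pi.smul_apply, Finset.sum_apply, smul_eq_mul]
      exact mul_nonneg (inv_nonneg.2 hNpos.le) (Finset.sum_nonneg fun z _ => (hR z).1 x y)
    · simp only [Pi.smul_apply, Finset.sum_apply, smul_eq_mul, ← Finset.mul_sum]
      rw [Finset.sum_comm]
      simp only [(hR _).2.1, Finset.sum_const, Finset.card_univ, nsmul_eq_mul, ← hN]
      field_simp
    · simp only [Pi.smul_apply, Finset.sum_apply, smul_eq_mul, ← Finset.mul_sum]
      rw [Finset.sum_comm]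
      simp only [(hR _).2.2, Finset.sum_const, Finset.card_univ, nsmul_eq_mul, ← hN]
      field_simp
  have hQc : tableCost c (N⁻¹ • ∑ z, R z) = tableCost c Q₀ := by
    have h : tableCost c (∑ z, R z) = ∑ z, tableCost c (R z) :=
      map_sum (AddMonoidHom.mk' (tableCost c) (tableCost_add c)) R Finset.univ
    rw [tableCost_smul, h]
    simp only [hRc, Finset.sum_const, Finset.card_univ, nsmul_eq_mul, ← hN]
    field_simp
  refine ⟨_, hQ, fun R' hR' => hQc ▸ hmin R' hR', ?_, fun x y => ⟨hopt _ hQ hQc x y, fun h => ?_⟩⟩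
  · rw [hot, hQc, ENNReal.toReal_ofReal (tableCost_nonneg c hQ₀.1)]
  · simp only [Pi.smul_apply, Finset.sum_apply, smul_eq_mul]
    refine mul_pos (inv_pos.2 hNpos) ?_
    exact Finset.sum_pos' (fun z _ => (hR z).1 x y) ⟨(x, y), Finset.mem_univ _, hRp _ h⟩

end Tables

/-! ### Signed couplings: bounds, limits and Lipschitz dependence -/

section SignedCouplings

variable {A B : Type*} [Fintype A] [Fintype B]

theorem signedCouplings_add {S : Set (A × B)} {bX bX' : A → ℝ} {bY bY' : B → ℝ} {β β' : A → B → ℝ}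
    (h : β ∈ signedCouplings S bX bY) (h' : β' ∈ signedCouplings S bX' bY') :
    β + β' ∈ signedCouplings S (bX + bX') (bY + bY') := by
  refine ⟨fun x => ?_, fun y => ?_, fun x y hxy => ?_⟩
  · simp [Finset.sum_add_distrib, h.1, h'.1]
  · simp [Finset.sum_add_distrib, h.2.1, h'.2.1]
  · by_cases h1 : β x y < 0
    · exact h.2.2 x y h1
    · refine h'.2.2 x y ?_
      simp only [Pi.add_apply] at hxy
      linarith [not_lt.1 h1]

/-- Only finitely many entries decrease with `t`, and each of them starts from a positive value.
Thus the sign condition describes the feasible directions at `Q`. -/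
theorem eventually_add_mul_nonneg {Q β : A → B → ℝ} (hQ : ∀ x y, 0 ≤ Q x y)
    (hβ : ∀ x y, β x y < 0 → 0 < Q x y) :
    ∀ᶠ t : ℝ in 𝓝[>] 0, ∀ x y, 0 ≤ Q x y + t * β x y := by
  refine eventually_all.2 fun x => eventually_all.2 fun y => ?_
  by_cases h : β x y < 0
  · have hc : Tendsto (fun t : ℝ => Q x y + t * β x y) (𝓝 0) (𝓝 (Q x y + 0 * β x y)) :=
      Continuous.tendsto (by fun_prop) _
    rw [zero_mul, add_zero] at hc
    exact nhdsWithin_le_nhds ((hc.eventually (lt_mem_nhds (hβ x y h))).mono fun t ht => ht.le)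
  · filter_upwards [self_mem_nhdsWithin] with t ht
    exact add_nonneg (hQ x y) (mul_nonneg (le_of_lt ht) (not_lt.1 h))

variable {c : A → B → ℝ≥0} {S : Set (A × B)} {p : A → ℝ} {q : B → ℝ} {Q : A → B → ℝ}

/-- For small `t > 0` the table `Q + t β` competes with the optimal `Q`. This is the condition on
recession directions that the Hoffman bound requires. -/
theorem tableCost_nonneg_of_mem_signedCouplings_zero (hQ : Q ∈ tables p q)
    (hmin : ∀ R ∈ tables p q, tableCost c Q ≤ tableCost c R) (hS : ∀ x y, (x, y) ∈ S → 0 < Q x y)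
    {β : A → B → ℝ} (hβ : β ∈ signedCouplings S 0 0) : 0 ≤ tableCost c β := by
  obtain ⟨t, ht, htpos⟩ := ((eventually_add_mul_nonneg hQ.1
    (fun x y h => hS x y (hβ.2.2 x y h))).and self_mem_nhdsWithin).exists
  have hmem : Q + t • β ∈ tables p q := by
    refine ⟨ht, fun x => ?_, fun y => ?_⟩
    · simp [Finset.sum_add_distrib, hQ.2.1, ← Finset.mul_sum, hβ.1]
    · simp [Finset.sum_add_distrib, hQ.2.2, ← Finset.mul_sum, hβ.2.1]
  have := hmin _ hmem
  rw [tableCost_add, tableCost_smul] at this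
  exact nonneg_of_mul_nonneg_right (by linarith) htpos

/-- Signed couplings can be chosen of size proportional to their marginals, without raising the
cost. -/
theorem exists_bounded_signedCoupling (hQ : Q ∈ tables p q)
    (hmin : ∀ R ∈ tables p q, tableCost c Q ≤ tableCost c R)
    (hS : ∀ x y, (x, y) ∈ S → 0 < Q x y) :
    ∃ K : ℝ, 0 ≤ K ∧ ∀ bX bY, ∀ β ∈ signedCouplings S bX bY,
      ∃ β' ∈ signedCouplings S bX bY, tableCost c β' ≤ tableCost c β ∧
        ∀ x y, |β' x y| ≤ K * ‖(bX, bY)‖ := by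
  classical
  -- Signed couplings as a cone: each cell contributes its pair of marginals with a positive sign,
  -- and cells in `S` also with a negative sign. `T` turns coefficients back into a table.
  let V₀ : A × B → (A → ℝ) × (B → ℝ) := fun z => (Pi.single z.1 1, Pi.single z.2 1)
  let V : (A × B) ⊕ (A × B) → (A → ℝ) × (B → ℝ) :=
    Sum.elim V₀ fun z => if z ∈ S then - V₀ z else 0
  let w : (A × B) ⊕ (A × B) → ℝ :=
    Sum.elim (fun z => (c z.1 z.2 : ℝ)) fun z => if z ∈ S then - (c z.1 z.2 : ℝ) else 0
  let T : ((A × B) ⊕ (A × B) → ℝ) → A → B → ℝ := fun l x y =>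
    l (Sum.inl (x, y)) - if (x, y) ∈ S then l (Sum.inr (x, y)) else 0
  have hV : ∀ l, ∑ i, l i • V i = (fun x => ∑ y, T l x y, fun y => ∑ x, T l x y) := by
    intro l
    have h1 : ∑ i, l i • V i = ∑ z : A × B, T l z.1 z.2 • V₀ z := by
      rw [Fintype.sum_sum_type, ← Finset.sum_add_distrib]
      refine Finset.sum_congr rfl fun z _ => ?_
      by_cases hz : z ∈ S <;> simp [V, T, hz, sub_eq_add_neg, add_smul]
    rw [h1]
    ext x
    · simp [V₀, Fintype.sum_prod_type, Prod.fst_sum, Finset.sum_apply, Pi.single_apply]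
    · simp [V₀, Fintype.sum_prod_type, Prod.snd_sum, Finset.sum_apply, Pi.single_apply]
  have hw : ∀ l, ∑ i, l i * w i = tableCost c (T l) := by
    intro l
    rw [tableCost, ← Fintype.sum_prod_type' (fun x y => T l x y * (c x y : ℝ)),
      Fintype.sum_sum_type, ← Finset.sum_add_distrib]
    refine Finset.sum_congr rfl fun z _ => ?_
    by_cases hz : z ∈ S <;> simp [w, T, hz, sub_eq_add_neg, add_mul]
  have hT : ∀ l, (∀ i, 0 ≤ l i) → ∀ x y, T l x y < 0 → (x, y) ∈ S := by
    intro l hl x y h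
    by_contra hxy
    simp only [T, hxy, if_false, sub_zero] at h
    linarith [hl (Sum.inl (x, y))]
  obtain ⟨K, hK0, hK⟩ := exists_bounded_nonneg_combination V w (fun m hm hmV => by
    rw [hw]
    refine tableCost_nonneg_of_mem_signedCouplings_zero hQ hmin hS ⟨fun x => ?_, fun y => ?_, hT m hm⟩
    · rw [hV] at hmV
      exact congrFun (congrArg Prod.fst hmV) x
    · rw [hV] at hmV
      exact congrFun (congrArg Prod.snd hmV) y)
  refine ⟨K, hK0, fun bX bY β hβ => ?_⟩
  -- Positive and negative parts of `β`. Off `S`, where `T` ignores the second family, the negative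
  -- part vanishes.
  let l : (A × B) ⊕ (A × B) → ℝ := Sum.elim (fun z => max (β z.1 z.2) 0)
    fun z => max (- β z.1 z.2) 0
  have hTl : T l = β := by
    funext x y
    by_cases hz : (x, y) ∈ S
    · simp only [T, l, hz, if_true, Sum.elim_inl, Sum.elim_inr]
      rcases le_total (β x y) 0 with h | h
      · rw [max_eq_right h, max_eq_left (by linarith)]; ring
      · rw [max_eq_left h, max_eq_right (by linarith)]; ring
    · have : 0 ≤ β x y := by
        by_contra h
        exact hz (hβ.2.2 x y (not_le.1 h))
      simp [T, l, hz, this]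
  have hlV : ∑ i, l i • V i = (bX, bY) := by
    rw [hV, hTl]
    ext x
    · exact hβ.1 x
    · exact hβ.2.1 x
  obtain ⟨l', h1, h2, h3, h4⟩ := hK l (by rintro (z | z) <;> simp [l])
  rw [hlV] at h2 h4
  rw [hw, hw, hTl] at h3
  refine ⟨T l', ⟨fun x => ?_, fun y => ?_, hT l' h1⟩, h3, fun x y => ?_⟩
  · rw [hV] at h2
    exact congrFun (congrArg Prod.fst h2) x
  · rw [hV] at h2
    exact congrFun (congrArg Prod.snd h2) y
  · have e1 := h1 (Sum.inl (x, y))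
    have e2 := h1 (Sum.inr (x, y))
    have e3 := h4 (Sum.inl (x, y))
    have e4 := h4 (Sum.inr (x, y))
    simp only [T]
    rw [abs_le]
    split_ifs <;> constructor <;> linarith

/-- Limits of signed couplings: feasibility with cost at most `a` is preserved under convergence of
the marginals and of the cost bounds. -/
theorem exists_signedCoupling_of_tendsto (hQ : Q ∈ tables p q)
    (hmin : ∀ R ∈ tables p q, tableCost c Q ≤ tableCost c R)
    (hS : ∀ x y, (x, y) ∈ S → 0 < Q x y) {b : ℕ → (A → ℝ) × (B → ℝ)} {b₀ : (A → ℝ) × (B → ℝ)}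
    (hb : Tendsto b atTop (𝓝 b₀)) {a : ℕ → ℝ} {a₀ : ℝ} (ha : Tendsto a atTop (𝓝 a₀))
    (h : ∀ k, ∃ β ∈ signedCouplings S (b k).1 (b k).2, tableCost c β ≤ a k) :
    ∃ β ∈ signedCouplings S b₀.1 b₀.2, tableCost c β ≤ a₀ := by
  obtain ⟨K, hK0, hK⟩ := exists_bounded_signedCoupling (S := S) hQ hmin hS
  -- The marginals converge and hence are bounded, so tables rechosen by the Hoffman bound stay in a
  -- compact ball.
  have h' : ∀ k, ∃ β ∈ signedCouplings S (b k).1 (b k).2, tableCost c β ≤ a k ∧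
      ∀ x y, |β x y| ≤ K * ‖b k‖ := by
    intro k
    obtain ⟨β, hβ, hc⟩ := h k
    obtain ⟨β', hβ', hc', hn⟩ := hK _ _ β hβ
    exact ⟨β', hβ', hc'.trans hc, hn⟩
  choose β hβ hc hn using h'
  obtain ⟨M, hM⟩ := hb.norm.bddAbove_range
  have hbd : ∀ k, β k ∈ Metric.closedBall (0 : A → B → ℝ) (K * max M 0) := by
    intro k
    have h0 : 0 ≤ K * max M 0 := mul_nonneg hK0 (le_max_right _ _)
    rw [mem_closedBall_zero_iff, pi_norm_le_iff_of_nonneg h0]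
    intro x
    rw [pi_norm_le_iff_of_nonneg h0]
    intro y
    exact (hn k x y).trans (mul_le_mul_of_nonneg_left
      ((hM ⟨k, rfl⟩).trans (le_max_left _ _)) hK0)
  obtain ⟨β₀, -, φ, hφ, hlim⟩ := (isCompact_closedBall (0 : A → B → ℝ) _).tendsto_subseq hbd
  have hbφ := hb.comp hφ.tendsto_atTop
  have hxy : ∀ x y, Tendsto (fun k => β (φ k) x y) atTop (𝓝 (β₀ x y)) := fun x y =>
    tendsto_pi_nhds.1 (tendsto_pi_nhds.1 hlim x) y
  refine ⟨β₀, ⟨fun x => ?_, fun y => ?_, fun x y h0 => ?_⟩, ?_⟩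
  · refine tendsto_nhds_unique (tendsto_finsetSum Finset.univ fun y _ => hxy x y) ?_
    simp only [(hβ _).1]
    exact ((continuous_apply x).comp continuous_fst).continuousAt.tendsto.comp hbφ
  · refine tendsto_nhds_unique (tendsto_finsetSum Finset.univ fun x _ => hxy x y) ?_
    simp only [(hβ _).2.1]
    exact ((continuous_apply y).comp continuous_snd).continuousAt.tendsto.comp hbφ
  · obtain ⟨k, hk⟩ := ((hxy x y).eventually_lt_const h0).exists
    exact (hβ (φ k)).2.2 x y hk
  · exact le_of_tendsto_of_tendsto' ((continuous_tableCost c).continuousAt.tendsto.comp hlim)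
      (ha.comp hφ.tendsto_atTop) fun k => hc (φ k)

/-- The directions in which the probability vector `p` can be perturbed. -/
def perturbations (p : A → ℝ) : Set (A → ℝ) := {b | ∑ x, b x = 0 ∧ ∀ x, p x = 0 → b x = 0}

theorem sub_mem_perturbations {b b' : A → ℝ} (h : b ∈ perturbations p) (h' : b' ∈ perturbations p) :
    b - b' ∈ perturbations p :=
  ⟨by simp [Finset.sum_sub_distrib, h.1, h'.1], fun x hx => by simp [h.2 x hx, h'.2 x hx]⟩

theorem isClosed_perturbations : IsClosed (perturbations p) := by
  have : perturbations p = {b | ∑ x, b x = 0} ∩ ⋂ x, ⋂ _ : p x = 0, {b | b x = 0} := by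
    ext b; simp [perturbations]
  rw [this]
  refine (isClosed_eq (by fun_prop) continuous_const).inter ?_
  exact isClosed_iInter fun x => isClosed_iInter fun _ => isClosed_eq (by fun_prop) continuous_const

theorem eventually_perturbation_nonneg {b : A → ℝ} (hp : ∀ x, 0 ≤ p x) (hb : b ∈ perturbations p) :
    ∀ᶠ t : ℝ in 𝓝[>] 0, ∀ x, 0 ≤ p x + t * b x := by
  have := eventually_add_mul_nonneg (Q := fun x (_ : Unit) => p x) (β := fun x _ => b x)
    (fun x _ => hp x) (fun x _ h => (hp x).lt_of_ne fun h0 => by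
      rw [hb.2 x h0.symm] at h; exact lt_irrefl _ h)
  filter_upwards [this] with t ht x using ht x ()

/-- For small `t > 0` the vectors `p + t bX` and `q + t bY` are probability vectors. With `R` their
product coupling, the table `(R - Q)/t` has the right marginals and can be negative only where `Q`
is positive. -/
theorem signedCouplings_nonempty (hQ : Q ∈ tables p q) (hS : ∀ x y, 0 < Q x y → (x, y) ∈ S)
    (hp1 : ∑ x, p x = 1) (hq1 : ∑ y, q y = 1)
    {bX : A → ℝ} {bY : B → ℝ} (hX : bX ∈ perturbations p) (hY : bY ∈ perturbations q) :
    (signedCouplings S bX bY).Nonempty := by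
  have hp : ∀ x, 0 ≤ p x := fun x => hQ.2.1 x ▸ Finset.sum_nonneg fun y _ => hQ.1 x y
  have hq : ∀ y, 0 ≤ q y := fun y => hQ.2.2 y ▸ Finset.sum_nonneg fun x _ => hQ.1 x y
  obtain ⟨t, ⟨htX, htY⟩, ht⟩ := (((eventually_perturbation_nonneg hp hX).and
    (eventually_perturbation_nonneg hq hY)).and self_mem_nhdsWithin).exists
  have ht : 0 < t := ht
  have hR := mul_mem_tables htX htY
    (by rw [Finset.sum_add_distrib, ← Finset.mul_sum, hX.1, hp1]; simp)
    (by rw [Finset.sum_add_distrib, ← Finset.mul_sum, hY.1, hq1]; simp)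
  set R : A → B → ℝ := fun x y => (p x + t * bX x) * (q y + t * bY y) with hRdef
  refine ⟨fun x y => t⁻¹ * (R x y - Q x y), fun x => ?_, fun y => ?_, fun x y h => ?_⟩
  · rw [← Finset.mul_sum, Finset.sum_sub_distrib, hR.2.1, hQ.2.1]
    field_simp
    ring
  · rw [← Finset.mul_sum, Finset.sum_sub_distrib, hR.2.2, hQ.2.2]
    field_simp
    ring
  · refine hS x y ?_
    have h1 := neg_of_mul_neg_right h (inv_pos.2 ht).le
    linarith [hR.1 x y]

/-- On the perturbation directions the least cost of a signed coupling is Lipschitz. -/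
theorem exists_signedCoupling_lipschitz (hQ : Q ∈ tables p q)
    (hmin : ∀ R ∈ tables p q, tableCost c Q ≤ tableCost c R)
    (hS : ∀ x y, 0 < Q x y ↔ (x, y) ∈ S) (hp1 : ∑ x, p x = 1) (hq1 : ∑ y, q y = 1) :
    ∃ K : ℝ, 0 ≤ K ∧ ∀ bX ∈ perturbations p, ∀ bX' ∈ perturbations p, ∀ bY ∈ perturbations q,
      ∀ bY' ∈ perturbations q, ∀ β ∈ signedCouplings S bX bY,
      ∃ β' ∈ signedCouplings S bX' bY',
        tableCost c β' ≤ tableCost c β + K * ‖(bX' - bX, bY' - bY)‖ := by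
  obtain ⟨K, hK0, hK⟩ := exists_bounded_signedCoupling (S := S) hQ hmin fun x y => (hS x y).2
  refine ⟨K * ∑ x, ∑ y, (c x y : ℝ), mul_nonneg hK0 (Finset.sum_nonneg fun x _ =>
    Finset.sum_nonneg fun y _ => (c x y).2), ?_⟩
  intro bX hbX bX' hbX' bY hbY bY' hbY' β hβ
  -- The correction `γ` couples the increments of the marginals. Its entries are bounded by `K`
  -- times their norm, so its cost picks up the factor `∑ c`.
  obtain ⟨γ₀, hγ₀⟩ := signedCouplings_nonempty hQ (fun x y => (hS x y).1) hp1 hq1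
    (sub_mem_perturbations hbX' hbX) (sub_mem_perturbations hbY' hbY)
  obtain ⟨γ, hγ, -, hγn⟩ := hK _ _ γ₀ hγ₀
  refine ⟨β + γ, by simpa using signedCouplings_add hβ hγ, ?_⟩
  rw [tableCost_add]
  have : tableCost c γ ≤ K * (∑ x, ∑ y, (c x y : ℝ)) * ‖(bX' - bX, bY' - bY)‖ := by
    rw [mul_right_comm]
    simp only [tableCost, Finset.mul_sum]
    exact Finset.sum_le_sum fun x _ => Finset.sum_le_sum fun y _ =>
      mul_le_mul_of_nonneg_right ((le_abs_self _).trans (hγn x y)) (c x y).2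
  linarith

/-! ### Attainment and lower semicontinuity of `θ` -/

section Theta

variable [MeasurableSpace A] [MeasurableSingletonClass A]
  [MeasurableSpace B] [MeasurableSingletonClass B]

/-- Tables of cost at most `a + 1/(k+1)` can be chosen bounded, and a limit point has cost at most
`a`. This trades extended-real inequalities for actual tables. -/
theorem theta_le_iff (c : A → B → ℝ≥0) (μ : Measure A) (ν : Measure B)
    [IsProbabilityMeasure μ] [IsProbabilityMeasure ν] (bX : A → ℝ) (bY : B → ℝ) (a : ℝ) :
    theta c μ ν bX bY ≤ a ↔ ∃ β ∈ signedCouplings (optSupport c μ ν) bX bY, tableCost c β ≤ a := by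
  constructor
  · intro h
    obtain ⟨Q, hQ, hmin, -, hS⟩ := exists_optimal_table c μ ν
    refine exists_signedCoupling_of_tendsto hQ hmin (fun x y => (hS x y).2)
      (b := fun _ => (bX, bY)) tendsto_const_nhds
      (a := fun k : ℕ => a + 1 / ((k : ℝ) + 1)) (a₀ := a) ?_ fun k => ?_
    · simpa using tendsto_one_div_add_atTop_nhds_zero_nat.const_add a
    · have hlt : theta c μ ν bX bY < ((a + 1 / ((k : ℝ) + 1) : ℝ) : EReal) := by
        refine h.trans_lt (EReal.coe_lt_coe_iff.2 ?_)
        have : (0 : ℝ) < 1 / ((k : ℝ) + 1) := by positivity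
        linarith
      simp only [theta, iInf_lt_iff] at hlt
      obtain ⟨β, hβ, h⟩ := hlt
      exact ⟨β, hβ, (EReal.coe_lt_coe_iff.1 h).le⟩
  · rintro ⟨β, hβ, h⟩
    exact (iInf₂_le β hβ).trans (EReal.coe_le_coe_iff.2 h)

/-- `θ` is lower semicontinuous. -/
theorem isOpen_lt_theta (c : A → B → ℝ≥0) (μ : Measure A) (ν : Measure B)
    [IsProbabilityMeasure μ] [IsProbabilityMeasure ν] (a : ℝ) :
    IsOpen {b : (A → ℝ) × (B → ℝ) | (a : EReal) < theta c μ ν b.1 b.2} := by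
  obtain ⟨Q, hQ, hmin, -, hS⟩ := exists_optimal_table c μ ν
  rw [← isClosed_compl_iff]
  refine IsSeqClosed.isClosed fun b b₀ hb hlim => ?_
  simp only [Set.mem_compl_iff, Set.mem_ofPred_eq, not_lt, theta_le_iff] at hb ⊢
  exact exists_signedCoupling_of_tendsto hQ hmin (fun x y => (hS x y).2) hlim
    tendsto_const_nhds hb

end Theta

end SignedCouplings

/-! ### Empirical distributions and optimal matching of two sequences -/

section Empirical

variable {A B : Type*} [DecidableEq A] [DecidableEq B] {n : ℕ}

/-- The empirical distribution of a sequence. -/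
noncomputable def empirical (x : Fin n → A) (a : A) : ℝ := (∑ i, if x i = a then 1 else 0) / n

/-- The rescaled deviation `√n (p̂ - p)` of the empirical distribution. -/
noncomputable def fluctuation (p : A → ℝ) (x : Fin n → A) : A → ℝ :=
  fun a => √(n : ℝ) * (empirical x a - p a)

theorem empirical_nonneg (x : Fin n → A) (a : A) : 0 ≤ empirical x a :=
  div_nonneg (Finset.sum_nonneg fun i _ => by split_ifs <;> norm_num) (Nat.cast_nonneg n)

theorem empirical_apply_pos (hn : 0 < n) (x : Fin n → A) (i : Fin n) : 0 < empirical x (x i) :=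
  div_pos (Finset.sum_pos' (fun j _ => by split_ifs <;> norm_num)
    ⟨i, Finset.mem_univ i, by simp⟩) (by exact_mod_cast hn)

variable [Fintype A] [Fintype B]

theorem sum_comp_eq_empirical (hn : 0 < n) (x : Fin n → A) (f : A → ℝ) :
    ∑ i, f (x i) = n * ∑ a, empirical x a * f a := by
  have hn' : (n : ℝ) ≠ 0 := by exact_mod_cast hn.ne'
  simp only [empirical, Finset.mul_sum, Finset.sum_div, Finset.sum_mul]
  rw [Finset.sum_comm]
  refine Finset.sum_congr rfl fun i _ => ?_
  rw [Finset.sum_eq_single (x i)]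
  · simp only [if_true]; field_simp
  · intro b _ hb
    simp [Ne.symm hb]
  · simp

theorem sum_empirical (hn : 0 < n) (x : Fin n → A) : ∑ a, empirical x a = 1 := by
  have hn' : (n : ℝ) ≠ 0 := by exact_mod_cast hn.ne'
  have := sum_comp_eq_empirical hn x fun _ => 1
  simp only [Finset.sum_const, Finset.card_univ, Fintype.card_fin, nsmul_eq_mul, mul_one] at this
  exact mul_left_cancel₀ hn' (by rw [← this, mul_one])

theorem empirical_prod_mem_tables (x : Fin n → A) (y : Fin n → B) :
    (fun a b => empirical (fun i => (x i, y i)) (a, b)) ∈ tables (empirical x) (empirical y) := by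
  refine ⟨fun a b => empirical_nonneg _ _, fun a => ?_, fun b => ?_⟩
  · simp only [empirical, ← Finset.sum_div]
    rw [Finset.sum_comm]
    congr 1
    refine Finset.sum_congr rfl fun i _ => ?_
    by_cases h : x i = a <;> simp [h]
  · simp only [empirical, ← Finset.sum_div]
    rw [Finset.sum_comm]
    congr 1
    refine Finset.sum_congr rfl fun i _ => ?_
    by_cases h : y i = b <;> simp [h]

theorem tableCost_empirical_prod (hn : 0 < n) (c : A → B → ℝ≥0) (x : Fin n → A) (y : Fin n → B) :
    tableCost c (fun a b => empirical (fun i => (x i, y i)) (a, b)) = avgCost c n x y := by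
  have hn' : (n : ℝ) ≠ 0 := by exact_mod_cast hn.ne'
  have := sum_comp_eq_empirical hn (fun i => (x i, y i)) fun z => (c z.1 z.2 : ℝ)
  rw [avgCost, this, Fintype.sum_prod_type, tableCost]
  field_simp

variable {c : A → B → ℝ≥0} {S : Set (A × B)} {p : A → ℝ} {q : B → ℝ} {Q : A → B → ℝ}

/-- The witness is the rescaled deviation of the joint empirical table from `Q`. Since the empirical
table is nonnegative, the deviation is negative only where `Q` is positive. -/
theorem exists_signedCoupling_fluctuation (hn : 0 < n) (hQ : Q ∈ tables p q)
    (hS : ∀ x y, 0 < Q x y → (x, y) ∈ S) (x : Fin n → A) (y : Fin n → B) :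
    ∃ β ∈ signedCouplings S (fluctuation p x) (fluctuation q y),
      tableCost c β = √(n : ℝ) * (avgCost c n x y - tableCost c Q) := by
  have hE := empirical_prod_mem_tables x y
  set E : A → B → ℝ := fun a b => empirical (fun i => (x i, y i)) (a, b) with hEdef
  refine ⟨√(n : ℝ) • (E - Q), ⟨fun a => ?_, fun b => ?_, fun a b h => hS a b ?_⟩, ?_⟩
  · simp only [Pi.smul_apply, Pi.sub_apply, smul_eq_mul, ← Finset.mul_sum, Finset.sum_sub_distrib,
      hE.2.1, hQ.2.1, fluctuation]
  · simp only [Pi.smul_apply, Pi.sub_apply, smul_eq_mul, ← Finset.mul_sum, Finset.sum_sub_distrib,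
      hE.2.2, hQ.2.2, fluctuation]
  · have h1 := neg_of_mul_neg_right h (Real.sqrt_nonneg n)
    simp only [Pi.sub_apply] at h1
    linarith [hE.1 a b]
  · rw [tableCost_smul, tableCost_sub, hEdef, tableCost_empirical_prod hn]

/-- By Birkhoff's theorem, two sequences can be matched at a cost of at most that of any coupling of
their empirical distributions. -/
theorem exists_perm_avgCost_le (hn : 0 < n) (c : A → B → ℝ≥0) (x : Fin n → A) (y : Fin n → B)
    {R : A → B → ℝ} (hR : R ∈ tables (empirical x) (empirical y)) :
    ∃ τ : Equiv.Perm (Fin n), avgCost c n x (y ∘ τ) ≤ tableCost c R := by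
  have hn' : (0 : ℝ) < n := by exact_mod_cast hn
  have hRx : ∀ a b, empirical x a = 0 → R a b = 0 := fun a b h => by
    have := hR.2.1 a
    rw [h, Finset.sum_eq_zero_iff_of_nonneg fun b _ => hR.1 a b] at this
    exact this b (Finset.mem_univ b)
  have hRy : ∀ a b, empirical y b = 0 → R a b = 0 := fun a b h => by
    have := hR.2.2 b
    rw [h, Finset.sum_eq_zero_iff_of_nonneg fun a _ => hR.1 a b] at this
    exact this a (Finset.mem_univ a)
  -- The mass `R a b` is spread evenly over the pairs of positions carrying the letters `a`, `b`;
  -- one factor `n` is dropped to make row and column sums equal to `1`.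
  let M : Matrix (Fin n) (Fin n) ℝ := fun i j =>
    R (x i) (y j) / (n * empirical x (x i) * empirical y (y j))
  have hM : M ∈ doublyStochastic ℝ (Fin n) := by
    rw [mem_doublyStochastic_iff_sum]
    refine ⟨fun i j => ?_, fun i => ?_, fun j => ?_⟩
    · exact div_nonneg (hR.1 _ _) (mul_nonneg (mul_nonneg hn'.le (empirical_nonneg _ _))
        (empirical_nonneg _ _))
    · have h1 := sum_comp_eq_empirical hn y fun b =>
        R (x i) b / (n * empirical x (x i) * empirical y b)
      have h2 : ∀ b, empirical y b * (R (x i) b / (n * empirical x (x i) * empirical y b)) =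
          R (x i) b / (n * empirical x (x i)) := by
        intro b
        by_cases hb : empirical y b = 0
        · simp [hb, hRy _ _ hb]
        · have := (empirical_apply_pos hn x i).ne'
          field_simp
      rw [show ∑ j, M i j = _ from h1]
      simp only [h2, ← Finset.sum_div, hR.2.1]
      have := (empirical_apply_pos hn x i).ne'
      field_simp
    · have h1 := sum_comp_eq_empirical hn x fun a =>
        R a (y j) / (n * empirical x a * empirical y (y j))
      have h2 : ∀ a, empirical x a * (R a (y j) / (n * empirical x a * empirical y (y j))) =
          R a (y j) / (n * empirical y (y j)) := by
        intro a
        by_cases hb : empirical x a = 0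
        · simp [hb, hRx _ _ hb]
        · have := (empirical_apply_pos hn y j).ne'
          field_simp
      rw [show ∑ i, M i j = _ from h1]
      simp only [h2, ← Finset.sum_div, hR.2.2]
      have := (empirical_apply_pos hn y j).ne'
      field_simp
  obtain ⟨w, hw0, hw1, hwM⟩ := exists_eq_sum_perm_of_mem_doublyStochastic hM
  have hcost : ∑ i, ∑ j, M i j * (c (x i) (y j) : ℝ) = n * tableCost c R := by
    have h1 : ∀ i, ∑ j, M i j * (c (x i) (y j) : ℝ) =
        ∑ b, R (x i) b * c (x i) b / empirical x (x i) := by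
      intro i
      have h1 := sum_comp_eq_empirical hn y fun b =>
        R (x i) b / (n * empirical x (x i) * empirical y b) * (c (x i) b : ℝ)
      rw [show ∑ j, M i j * (c (x i) (y j) : ℝ) = _ from h1, Finset.mul_sum]
      refine Finset.sum_congr rfl fun b _ => ?_
      by_cases hb : empirical y b = 0
      · simp [hb, hRy _ _ hb]
      · have := (empirical_apply_pos hn x i).ne'
        field_simp
    simp only [h1]
    rw [sum_comp_eq_empirical hn x fun a => ∑ b, R a b * c a b / empirical x a, tableCost]
    congr 1
    refine Finset.sum_congr rfl fun a _ => ?_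
    rw [Finset.mul_sum]
    refine Finset.sum_congr rfl fun b _ => ?_
    by_cases hb : empirical x a = 0
    · simp [hb, hRx _ _ hb]
    · field_simp
  have hperm : ∑ i, ∑ j, M i j * (c (x i) (y j) : ℝ) =
      ∑ σ : Equiv.Perm (Fin n), w σ * (n * avgCost c n x (y ∘ σ)) := by
    have h1 : ∀ i j, M i j = ∑ σ : Equiv.Perm (Fin n), w σ * if σ i = j then 1 else 0 := by
      intro i j
      rw [← hwM]
      simp [Matrix.sum_apply, Equiv.Perm.permMatrix, PEquiv.toMatrix_apply]
    simp only [h1, Finset.sum_mul]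
    have h2 : ∀ i, ∑ j, ∑ σ : Equiv.Perm (Fin n), (w σ * if σ i = j then 1 else 0) *
        (c (x i) (y j) : ℝ) = ∑ σ : Equiv.Perm (Fin n), w σ * (c (x i) (y (σ i)) : ℝ) := by
      intro i
      rw [Finset.sum_comm]
      refine Finset.sum_congr rfl fun σ _ => ?_
      simp
    simp only [h2]
    rw [Finset.sum_comm]
    refine Finset.sum_congr rfl fun σ _ => ?_
    rw [← Finset.mul_sum, avgCost, mul_div_cancel₀ _ hn'.ne']
    rfl
  -- The matching costs, averaged with the Birkhoff weights, equal `tableCost c R`, so they cannot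
  -- all exceed it.
  by_contra hcon
  push Not at hcon
  have hlt : ∑ σ, w σ * (n * tableCost c R) < ∑ σ, w σ * (n * avgCost c n x (y ∘ σ)) := by
    have hex : ∃ σ, 0 < w σ := by
      by_contra h
      push Not at h
      have : ∑ σ, w σ ≤ 0 := Finset.sum_nonpos fun σ _ => h σ
      linarith
    obtain ⟨σ, hσ⟩ := hex
    refine Finset.sum_lt_sum (fun σ _ => ?_) ⟨σ, Finset.mem_univ σ, ?_⟩
    · exact mul_le_mul_of_nonneg_left (mul_le_mul_of_nonneg_left (hcon σ).le hn'.le) (hw0 σ)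
    · exact mul_lt_mul_of_pos_left (mul_lt_mul_of_pos_left (hcon σ) hn') hσ
  rw [← Finset.sum_mul, hw1, one_mul, ← hperm, hcost] at hlt
  exact lt_irrefl _ hlt

/-- Bounded marginals allow a `β` with entries at most `K * M`. As `Q` is positive on `S`, the table
`Q + β/√n` is nonnegative from some `n` on, uniformly in the sequences, and it couples their
empirical distributions. -/
theorem eventually_exists_perm_avgCost_le (hQ : Q ∈ tables p q)
    (hmin : ∀ R ∈ tables p q, tableCost c Q ≤ tableCost c R) (hS : ∀ x y, (x, y) ∈ S → 0 < Q x y)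
    (M D : ℝ) :
    ∀ᶠ n : ℕ in atTop, ∀ (x : Fin n → A) (y : Fin n → B),
      ‖(fluctuation p x, fluctuation q y)‖ ≤ M →
      (∃ β ∈ signedCouplings S (fluctuation p x) (fluctuation q y), tableCost c β ≤ D) →
      ∃ τ : Equiv.Perm (Fin n), avgCost c n x (y ∘ τ) ≤ tableCost c Q + D / √(n : ℝ) := by
  obtain ⟨K, hK0, hK⟩ := exists_bounded_signedCoupling (S := S) hQ hmin hS
  have hlim : Tendsto (fun n : ℕ => (K * M) / √(n : ℝ)) atTop (𝓝 0) :=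
    tendsto_const_nhds.div_atTop (Real.tendsto_sqrt_atTop.comp tendsto_natCast_atTop_atTop)
  have hsmall : ∀ᶠ n : ℕ in atTop, ∀ a b, (a, b) ∈ S → (K * M) / √(n : ℝ) ≤ Q a b := by
    refine eventually_all.2 fun a => eventually_all.2 fun b => ?_
    by_cases h : (a, b) ∈ S
    · filter_upwards [hlim.eventually (gt_mem_nhds (hS a b h))] with n hn _ using hn.le
    · exact Eventually.of_forall fun n h' => absurd h' h
  filter_upwards [hsmall, eventually_gt_atTop 0] with n hsm hn x y hM ⟨β₀, hβ₀, hc₀⟩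
  obtain ⟨β, hβ, hc, hb⟩ := hK _ _ β₀ hβ₀
  have hs : 0 < √(n : ℝ) := Real.sqrt_pos.2 (by exact_mod_cast hn)
  have hR : Q + (√(n : ℝ))⁻¹ • β ∈ tables (empirical x) (empirical y) := by
    refine ⟨fun a b => ?_, fun a => ?_, fun b => ?_⟩
    · simp only [Pi.add_apply, Pi.smul_apply, smul_eq_mul]
      by_cases h : β a b < 0
      · have h1 := hsm a b (hβ.2.2 a b h)
        have h2 : |β a b| ≤ K * M := (hb a b).trans (mul_le_mul_of_nonneg_left hM hK0)
        have h3 : - (K * M) ≤ β a b := (abs_le.1 h2).1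
        have h4 : (√(n : ℝ))⁻¹ * (- (K * M)) ≤ (√(n : ℝ))⁻¹ * β a b :=
          mul_le_mul_of_nonneg_left h3 (inv_nonneg.2 hs.le)
        rw [div_eq_inv_mul] at h1
        linarith
      · exact add_nonneg (hQ.1 a b) (mul_nonneg (inv_nonneg.2 hs.le) (not_lt.1 h))
    · simp only [Pi.add_apply, Pi.smul_apply, smul_eq_mul, Finset.sum_add_distrib,
        ← Finset.mul_sum, hQ.2.1, hβ.1, fluctuation]
      field_simp
      ring
    · simp only [Pi.add_apply, Pi.smul_apply, smul_eq_mul, Finset.sum_add_distrib,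
        ← Finset.mul_sum, hQ.2.2, hβ.2.1, fluctuation]
      field_simp
      ring
  obtain ⟨τ, hτ⟩ := exists_perm_avgCost_le hn c x y hR
  refine ⟨τ, hτ.trans ?_⟩
  rw [tableCost_add, tableCost_smul, div_eq_inv_mul]
  have := mul_le_mul_of_nonneg_left (hc.trans hc₀) (inv_nonneg.2 hs.le)
  linarith

/-- The sum condition is automatic, and the empirical mass of a letter vanishes exactly when the
letter does not occur. This links admissible directions to sequences of positive probability. -/
theorem fluctuation_mem_perturbations_iff (hn : 0 < n) (hp1 : ∑ a, p a = 1) (x : Fin n → A) :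
    fluctuation p x ∈ perturbations p ↔ ∀ i, p (x i) ≠ 0 := by
  have hn' : (0 : ℝ) < n := by exact_mod_cast hn
  have hs : 0 < √(n : ℝ) := Real.sqrt_pos.2 hn'
  constructor
  · rintro ⟨-, h⟩ i hi
    have h1 := h _ hi
    simp only [fluctuation, hi, sub_zero, mul_eq_zero, hs.ne', false_or, empirical,
      div_eq_zero_iff, hn'.ne', or_false] at h1
    rw [Finset.sum_eq_zero_iff_of_nonneg fun j _ => by split_ifs <;> norm_num] at h1
    simpa using h1 i (Finset.mem_univ i)
  · intro h
    refine ⟨?_, fun a ha => ?_⟩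
    · simp only [fluctuation, ← Finset.mul_sum, Finset.sum_sub_distrib, hp1, sum_empirical hn,
        sub_self, mul_zero]
    · have : empirical x a = 0 := by
        rw [empirical, Finset.sum_eq_zero, zero_div]
        intro i _
        rw [if_neg]
        rintro rfl
        exact h i ha
      simp [fluctuation, this, ha]

end Empirical

/-! ### Symmetrization of couplings of product laws -/

section Symmetrization

variable {A B : Type*} {n : ℕ}

theorem avgCost_comp_perm (c : A → B → ℝ≥0) (x : Fin n → A) (y : Fin n → B)
    (σ : Equiv.Perm (Fin n)) : avgCost c n (x ∘ σ) (y ∘ σ) = avgCost c n x y := by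
  unfold avgCost
  congr 1
  exact Equiv.sum_comp σ fun i => (c (x i) (y i) : ℝ)

variable [Fintype A] [MeasurableSpace A] [MeasurableSingletonClass A]
  [Fintype B] [MeasurableSpace B] [MeasurableSingletonClass B]

theorem map_comp_perm_pi (μ : Measure A) [IsProbabilityMeasure μ] (σ : Equiv.Perm (Fin n)) :
    (Measure.pi fun _ : Fin n => μ).map (fun x => x ∘ σ) = Measure.pi fun _ : Fin n => μ := by
  refine Measure.ext_of_singleton fun x => ?_
  rw [Measure.map_apply Measurable.of_discrete (measurableSet_singleton x)]
  have : (fun x : Fin n → A => x ∘ σ) ⁻¹' {x} = {x ∘ σ.symm} := by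
    ext z
    simp only [Set.mem_preimage, Set.mem_singleton_iff]
    constructor
    · rintro rfl; funext i; simp
    · rintro rfl; funext i; simp
  rw [this, Measure.pi_singleton, Measure.pi_singleton]
  exact Equiv.prod_comp σ.symm fun i => μ {x i}

/-- Any coupling of the product laws can be symmetrized after an optimal matching of the
coordinates. -/
theorem productExcessProb_le_of_mem_couplings (c : A → B → ℝ≥0) (a : ℝ)
    (μ : Measure A) [IsProbabilityMeasure μ] (ν : Measure B) [IsProbabilityMeasure ν]
    {m : Measure ((Fin n → A) × (Fin n → B))}
    (hm : m ∈ couplings (Measure.pi fun _ : Fin n => μ) (Measure.pi fun _ : Fin n => ν)) :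
    productExcessProb c n a μ ν ≤
      m {z | ∀ τ : Equiv.Perm (Fin n), a < avgCost c n z.1 (z.2 ∘ τ)} := by
  classical
  have : ∀ z : (Fin n → A) × (Fin n → B), ∃ τ : Equiv.Perm (Fin n),
      (∃ τ : Equiv.Perm (Fin n), avgCost c n z.1 (z.2 ∘ τ) ≤ a) →
        avgCost c n z.1 (z.2 ∘ τ) ≤ a := by
    intro z
    by_cases h : ∃ τ : Equiv.Perm (Fin n), avgCost c n z.1 (z.2 ∘ τ) ≤ a
    · exact ⟨h.choose, fun _ => h.choose_spec⟩
    · exact ⟨1, fun h' => absurd h' h⟩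
  choose τ hτ using this
  set N : ℝ≥0∞ := (Fintype.card (Equiv.Perm (Fin n)) : ℝ≥0∞) with hN
  have hN0 : N ≠ 0 := by rw [hN]; exact_mod_cast Fintype.card_ne_zero
  have hNt : N ≠ ∞ := ENNReal.natCast_ne_top _
  -- The matching `τ z` alone would distort the law of `y`, as it depends on `z`. The common
  -- permutation `σ`, averaged in `m'`, repairs this and leaves the cost unchanged.
  let F : Equiv.Perm (Fin n) → (Fin n → A) × (Fin n → B) → (Fin n → A) × (Fin n → B) :=
    fun σ z => (z.1 ∘ σ, z.2 ∘ (τ z * σ : Equiv.Perm (Fin n)))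
  let m' : Measure ((Fin n → A) × (Fin n → B)) := N⁻¹ • ∑ σ, m.map (F σ)
  have hF : ∀ σ, Measurable (F σ) := fun σ => Measurable.of_discrete
  have hm' : m' ∈ couplings (Measure.pi fun _ : Fin n => μ) (Measure.pi fun _ : Fin n => ν) := by
    constructor
    · refine Measure.ext_of_singleton fun x => ?_
      have h1 : ∀ σ, m.map (F σ) (Prod.fst ⁻¹' {x}) = (Measure.pi fun _ : Fin n => μ) {x} := by
        intro σ
        rw [← Measure.map_apply measurable_fst (measurableSet_singleton x),
          Measure.map_map measurable_fst (hF σ)]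
        have : (Prod.fst : (Fin n → A) × (Fin n → B) → _) ∘ F σ = (fun x => x ∘ σ) ∘ Prod.fst := rfl
        rw [this, ← Measure.map_map Measurable.of_discrete measurable_fst, hm.1, map_comp_perm_pi]
      rw [Measure.map_apply measurable_fst (measurableSet_singleton x)]
      simp only [m', Measure.smul_apply, Measure.finsetSum_apply, h1, Finset.sum_const,
        Finset.card_univ, smul_eq_mul, nsmul_eq_mul, ← hN]
      rw [← mul_assoc, ENNReal.inv_mul_cancel hN0 hNt, one_mul]
    · refine Measure.ext_of_singleton fun y => ?_
      have h1 : ∀ σ, m.map (F σ) (Prod.snd ⁻¹' {y}) =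
          ∫⁻ z, ({y} : Set (Fin n → B)).indicator 1 (z.2 ∘ (τ z * σ : Equiv.Perm (Fin n))) ∂m := by
        intro σ
        rw [Measure.map_apply (hF σ) (measurable_snd (measurableSet_singleton y)),
          ← lintegral_indicator_one (hF σ (measurable_snd (measurableSet_singleton y)))]
        rfl
      have h2 : ∀ σ : Equiv.Perm (Fin n),
          ∫⁻ z, ({y} : Set (Fin n → B)).indicator 1 (z.2 ∘ σ) ∂m =
            (Measure.pi fun _ : Fin n => ν) {y} := by
        intro σ
        rw [← lintegral_map (f := fun z => ({y} : Set (Fin n → B)).indicator 1 (z ∘ σ))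
          Measurable.of_discrete measurable_snd, hm.2,
          ← lintegral_map (f := ({y} : Set (Fin n → B)).indicator 1) Measurable.of_discrete
            (g := fun z => z ∘ σ) Measurable.of_discrete, map_comp_perm_pi,
          lintegral_indicator_one (measurableSet_singleton y)]
      rw [Measure.map_apply measurable_snd (measurableSet_singleton y)]
      simp only [m', Measure.smul_apply, Measure.finsetSum_apply, h1, smul_eq_mul]
      rw [← lintegral_finsetSum _ fun σ _ => Measurable.of_discrete]
      -- For each fixed `z`, left multiplication by `τ z` permutes the group, so averaging over `σ`
      -- erases `τ z`.
      have h3 : ∀ z : (Fin n → A) × (Fin n → B),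
          ∑ σ : Equiv.Perm (Fin n), ({y} : Set (Fin n → B)).indicator (1 : (Fin n → B) → ℝ≥0∞)
            (z.2 ∘ (τ z * σ : Equiv.Perm (Fin n))) =
          ∑ σ : Equiv.Perm (Fin n), ({y} : Set (Fin n → B)).indicator 1 (z.2 ∘ σ) := fun z =>
        Equiv.sum_comp (Equiv.mulLeft (τ z)) fun σ : Equiv.Perm (Fin n) =>
          ({y} : Set (Fin n → B)).indicator (1 : (Fin n → B) → ℝ≥0∞) (z.2 ∘ σ)
      simp only [h3]
      rw [lintegral_finsetSum _ fun σ _ => Measurable.of_discrete]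
      simp only [h2, Finset.sum_const, Finset.card_univ, nsmul_eq_mul, ← hN]
      rw [← mul_assoc, ENNReal.inv_mul_cancel hN0 hNt, one_mul]
  refine (iInf₂_le m' hm').trans ?_
  have h1 : ∀ σ, m.map (F σ) {z | (a : EReal) < (avgCost c n z.1 z.2 : EReal)} ≤
      m {z | ∀ τ : Equiv.Perm (Fin n), a < avgCost c n z.1 (z.2 ∘ τ)} := by
    intro σ
    rw [Measure.map_apply (hF σ) (Set.toFinite _).measurableSet]
    refine measure_mono fun z hz => ?_
    simp only [Set.mem_preimage, Set.mem_ofPred_eq, EReal.coe_lt_coe_iff, F] at hz ⊢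
    have h : (z.2 ∘ (τ z * σ : Equiv.Perm (Fin n))) = (z.2 ∘ τ z) ∘ σ := rfl
    rw [h, avgCost_comp_perm] at hz
    by_contra hcon
    push Not at hcon
    exact absurd (hτ z hcon) (not_le.2 hz)
  simp only [m', Measure.smul_apply, Measure.finsetSum_apply, smul_eq_mul]
  calc N⁻¹ * ∑ σ, m.map (F σ) {z | (a : EReal) < (avgCost c n z.1 z.2 : EReal)}
      ≤ N⁻¹ * ∑ _σ : Equiv.Perm (Fin n),
          m {z | ∀ τ : Equiv.Perm (Fin n), a < avgCost c n z.1 (z.2 ∘ τ)} := by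
        exact mul_le_mul' le_rfl (Finset.sum_le_sum fun σ _ => h1 σ)
    _ = _ := by
        simp only [Finset.sum_const, Finset.card_univ, nsmul_eq_mul, ← hN]
        rw [← mul_assoc, ENNReal.inv_mul_cancel hN0 hNt, one_mul]

end Symmetrization

/-! ### Transfer of finite couplings to nearby marginals -/

section Gluing

variable {I J U W : Type*} [Fintype I] [Fintype J] [Fintype U] [Fintype W]

/-- The factor `min 1 (r'/r)` retains as much of `r` as fits below `r'`, so only the deficit is
discarded. Where `r` vanishes the value is `0`, which is harmless. -/
theorem exists_scaling {L : Type*} {r r' : L → ℝ} (h : ∀ l, 0 ≤ r l) (h' : ∀ l, 0 ≤ r' l) :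
    ∃ s : L → ℝ, ∀ l, 0 ≤ s l ∧ s l ≤ 1 ∧ s l * r l ≤ r' l ∧
      r l * (1 - s l) ≤ max (r l - r' l) 0 := by
  refine ⟨fun l => min 1 (r' l / r l), fun l => ⟨le_min zero_le_one (div_nonneg (h' l) (h l)),
    min_le_left _ _, ?_, ?_⟩⟩
  · rcases (h l).eq_or_lt with h0 | h0
    · rw [← h0, mul_zero]; exact h' l
    · rw [← le_div_iff₀ h0]; exact min_le_right _ _
  · rcases (h l).eq_or_lt with h0 | h0
    · rw [← h0, zero_mul]; exact le_max_right _ _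
    · dsimp only
      rcases le_total 1 (r' l / r l) with h1 | h1
      · rw [min_eq_left h1]; simp
      · rw [min_eq_right h1]
        refine le_max_of_le_left (le_of_eq ?_)
        field_simp

/-- A coupling of `p` and `q` can be turned into one of `p'` and `q'` at the expense of the total
deficits of `p'` and `q'`. -/
theorem exists_table_of_perturbed_marginals {p p' : I → ℝ} {q q' : J → ℝ} {ψ : I → J → ℝ}
    (hψ : ψ ∈ tables p q) (hp1 : ∑ i, p i = 1) (hp' : ∀ i, 0 ≤ p' i) (hp'1 : ∑ i, p' i = 1)
    (hq' : ∀ j, 0 ≤ q' j) (hq'1 : ∑ j, q' j = 1) :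
    ∃ w ∈ tables p' q', ∀ h : I → J → ℝ, (∀ i j, 0 ≤ h i j) → (∀ i j, h i j ≤ 1) →
      ∑ i, ∑ j, w i j * h i j ≤ ∑ i, ∑ j, ψ i j * h i j +
        (∑ i, max (p i - p' i) 0 + ∑ j, max (q j - q' j) 0) := by
  have hp : ∀ x, 0 ≤ p x := fun x => hψ.2.1 x ▸ Finset.sum_nonneg fun y _ => hψ.1 x y
  have hq : ∀ y, 0 ≤ q y := fun y => hψ.2.2 y ▸ Finset.sum_nonneg fun x _ => hψ.1 x y
  obtain ⟨s, hs⟩ := exists_scaling hp hp'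
  obtain ⟨t, ht⟩ := exists_scaling hq hq'
  -- The thinned coupling has marginals below `p'` and `q'`. The missing marginals `a` and `b` have
  -- the same total `r`, bounded through `1 - s t ≤ (1 - s) + (1 - t)`, and are coupled by `a b /
  -- r`.
  set φ : I → J → ℝ := fun i j => ψ i j * (s i * t j) with hφ
  have hφ0 : ∀ i j, 0 ≤ φ i j := fun i j => mul_nonneg (hψ.1 i j) (mul_nonneg (hs i).1 (ht j).1)
  have hφψ : ∀ i j, φ i j ≤ ψ i j := fun i j =>
    mul_le_of_le_one_right (hψ.1 i j) (mul_le_one₀ (hs i).2.1 (ht j).1 (ht j).2.1)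
  set a : I → ℝ := fun i => p' i - ∑ j, φ i j with ha
  set b : J → ℝ := fun j => q' j - ∑ i, φ i j with hb
  set r : ℝ := 1 - ∑ i, ∑ j, φ i j with hr
  have ha0 : ∀ i, 0 ≤ a i := by
    intro i
    have : ∑ j, φ i j ≤ s i * p i := by
      rw [← hψ.2.1 i, Finset.mul_sum]
      refine Finset.sum_le_sum fun j _ => ?_
      have := mul_nonneg (mul_nonneg (hs i).1 (hψ.1 i j)) (sub_nonneg.2 (ht j).2.1)
      simp only [hφ]; nlinarith
    linarith [(hs i).2.2.1]
  have hb0 : ∀ j, 0 ≤ b j := by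
    intro j
    have : ∑ i, φ i j ≤ t j * q j := by
      rw [← hψ.2.2 j, Finset.mul_sum]
      refine Finset.sum_le_sum fun i _ => ?_
      have := mul_nonneg (mul_nonneg (ht j).1 (hψ.1 i j)) (sub_nonneg.2 (hs i).2.1)
      simp only [hφ]; nlinarith
    linarith [(ht j).2.2.1]
  have har : ∑ i, a i = r := by simp only [ha, hr, Finset.sum_sub_distrib, hp'1]
  have hbr : ∑ j, b j = r := by
    simp only [hb, hr, Finset.sum_sub_distrib, hq'1]
    rw [Finset.sum_comm]
  have hr0 : 0 ≤ r := har ▸ Finset.sum_nonneg fun i _ => ha0 i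
  have hrle : r ≤ ∑ i, max (p i - p' i) 0 + ∑ j, max (q j - q' j) 0 := by
    have h1 : r = ∑ i, ∑ j, ψ i j * (1 - s i * t j) := by
      simp only [hr, hφ, mul_sub, Finset.sum_sub_distrib, mul_one, hψ.2.1, hp1]
    have h2 : ∑ i, ∑ j, ψ i j * (1 - s i * t j) ≤
        ∑ i, ∑ j, (ψ i j * (1 - s i) + ψ i j * (1 - t j)) := by
      refine Finset.sum_le_sum fun i _ => Finset.sum_le_sum fun j _ => ?_
      have := mul_nonneg (hψ.1 i j)
        (mul_nonneg (sub_nonneg.2 (hs i).2.1) (sub_nonneg.2 (ht j).2.1))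
      nlinarith
    have h3 : ∑ i, ∑ j, (ψ i j * (1 - s i) + ψ i j * (1 - t j)) =
        ∑ i, p i * (1 - s i) + ∑ j, q j * (1 - t j) := by
      simp only [Finset.sum_add_distrib]
      congr 1
      · simp only [← Finset.sum_mul, hψ.2.1]
      · rw [Finset.sum_comm]
        simp only [← Finset.sum_mul, hψ.2.2]
    rw [h1]
    refine (h2.trans h3.le).trans (add_le_add ?_ ?_)
    · exact Finset.sum_le_sum fun i _ => (hs i).2.2.2
    · exact Finset.sum_le_sum fun j _ => (ht j).2.2.2
  -- If `r = 0`, nothing is missing, and the added term is `0` because division by zero gives `0`.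
  have haz : r = 0 → ∀ i, a i = 0 := fun h i => by
    rw [h, Finset.sum_eq_zero_iff_of_nonneg fun i _ => ha0 i] at har
    exact har i (Finset.mem_univ i)
  have hbz : r = 0 → ∀ j, b j = 0 := fun h j => by
    rw [h, Finset.sum_eq_zero_iff_of_nonneg fun j _ => hb0 j] at hbr
    exact hbr j (Finset.mem_univ j)
  refine ⟨fun i j => φ i j + a i * b j / r, ⟨fun i j => ?_, fun i => ?_, fun j => ?_⟩, ?_⟩
  · exact add_nonneg (hφ0 i j) (div_nonneg (mul_nonneg (ha0 i) (hb0 j)) hr0)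
  · rw [Finset.sum_add_distrib, ← Finset.sum_div, ← Finset.mul_sum, hbr]
    by_cases h : r = 0
    · have := haz h i
      simp only [ha] at this
      rw [h]; simp only [mul_zero, zero_div]; linarith
    · rw [mul_div_cancel_right₀ _ h]; simp only [ha]; ring
  · rw [Finset.sum_add_distrib, ← Finset.sum_div, ← Finset.sum_mul, har]
    by_cases h : r = 0
    · have := hbz h j
      simp only [hb] at this
      rw [h]; simp only [zero_mul, zero_div]; linarith
    · rw [mul_div_cancel_left₀ _ h]; simp only [hb]; ring
  · intro h h0 h1
    have e1 : ∑ i, ∑ j, (φ i j + a i * b j / r) * h i j ≤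
        ∑ i, ∑ j, (ψ i j * h i j + a i * b j / r) := by
      refine Finset.sum_le_sum fun i _ => Finset.sum_le_sum fun j _ => ?_
      rw [add_mul]
      refine add_le_add (mul_le_mul_of_nonneg_right (hφψ i j) (h0 i j)) ?_
      exact mul_le_of_le_one_right (div_nonneg (mul_nonneg (ha0 i) (hb0 j)) hr0) (h1 i j)
    refine e1.trans ?_
    simp only [Finset.sum_add_distrib]
    have e2 : ∑ i, ∑ j, a i * b j / r ≤ r := by
      simp only [← Finset.sum_div, ← Finset.mul_sum, hbr, ← Finset.sum_mul, har]
      by_cases h : r = 0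
      · simp [h]
      · rw [mul_div_cancel_right₀ _ h]
    linarith

variable [DecidableEq I] [DecidableEq J]

/-- The quotient is the conditional law given `f u`; it sums to `1` over each fibre of nonzero mass,
and `hF` removes the other fibres. -/
theorem sum_disintegration (P : U → ℝ) (f : U → I) (F : I → ℝ)
    (hF : ∀ i, (∑ u, if f u = i then P u else 0) = 0 → F i = 0) :
    ∑ u, F (f u) * (P u / ∑ v, if f v = f u then P v else 0) = ∑ i, F i := by
  have h1 : ∀ u, F (f u) * (P u / ∑ v, if f v = f u then P v else 0) =
      ∑ i, if f u = i then F i * (P u / ∑ v, if f v = i then P v else 0) else 0 := by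
    intro u; simp
  simp only [h1]
  rw [Finset.sum_comm]
  refine Finset.sum_congr rfl fun i _ => ?_
  have h2 : (∑ u, if f u = i then F i * (P u / ∑ v, if f v = i then P v else 0) else 0) =
      F i * ((∑ u, if f u = i then P u else 0) / ∑ v, if f v = i then P v else 0) := by
    rw [Finset.sum_div, Finset.mul_sum]
    refine Finset.sum_congr rfl fun u _ => ?_
    split_ifs <;> simp
  rw [h2]
  by_cases h : (∑ u, if f u = i then P u else 0) = 0
  · rw [hF i h, zero_mul]
  · rw [div_self h, mul_one]

/-- A coupling of finite laws `p`, `q` can be lifted to one of laws `P`, `R` on larger spaces whose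
images under `f`, `g` are close to `p`, `q`. -/
theorem exists_table_of_index_maps {p : I → ℝ} {q : J → ℝ} {ψ : I → J → ℝ} (hψ : ψ ∈ tables p q)
    (hp1 : ∑ i, p i = 1) {P : U → ℝ} {R : W → ℝ} (hP : ∀ u, 0 ≤ P u) (hP1 : ∑ u, P u = 1)
    (hR : ∀ v, 0 ≤ R v) (hR1 : ∑ v, R v = 1) (f : U → I) (g : W → J) :
    ∃ π ∈ tables P R, ∀ h : I → J → ℝ, (∀ i j, 0 ≤ h i j) → (∀ i j, h i j ≤ 1) →
      ∑ u, ∑ v, π u v * h (f u) (g v) ≤ ∑ i, ∑ j, ψ i j * h i j +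
        (∑ i, max (p i - ∑ u, if f u = i then P u else 0) 0 +
          ∑ j, max (q j - ∑ v, if g v = j then R v else 0) 0) := by
  set p' : I → ℝ := fun i => ∑ u, if f u = i then P u else 0 with hp'def
  set q' : J → ℝ := fun j => ∑ v, if g v = j then R v else 0 with hq'def
  have hp' : ∀ i, 0 ≤ p' i := fun i =>
    Finset.sum_nonneg fun u _ => by split_ifs <;> simp [hP u]
  have hq' : ∀ j, 0 ≤ q' j := fun j =>
    Finset.sum_nonneg fun v _ => by split_ifs <;> simp [hR v]
  have hp'1 : ∑ i, p' i = 1 := by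
    simp only [hp'def]; rw [Finset.sum_comm]; simpa using hP1
  have hq'1 : ∑ j, q' j = 1 := by
    simp only [hq'def]; rw [Finset.sum_comm]; simpa using hR1
  obtain ⟨w, hw, hwh⟩ := exists_table_of_perturbed_marginals hψ hp1 hp' hp'1 hq' hq'1
  have hwp : ∀ i j, p' i = 0 → w i j = 0 := fun i j h => by
    have := hw.2.1 i
    rw [h, Finset.sum_eq_zero_iff_of_nonneg fun b _ => hw.1 i b] at this
    exact this j (Finset.mem_univ j)
  have hwq : ∀ i j, q' j = 0 → w i j = 0 := fun i j h => by
    have := hw.2.2 j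
    rw [h, Finset.sum_eq_zero_iff_of_nonneg fun a _ => hw.1 a j] at this
    exact this i (Finset.mem_univ i)
  have hPz : ∀ u, p' (f u) = 0 → P u = 0 := fun u h => by
    rw [hp'def, Finset.sum_eq_zero_iff_of_nonneg fun u _ => by split_ifs <;> simp [hP u]] at h
    simpa using h u (Finset.mem_univ u)
  have hRz : ∀ v, q' (g v) = 0 → R v = 0 := fun v h => by
    rw [hq'def, Finset.sum_eq_zero_iff_of_nonneg fun v _ => by split_ifs <;> simp [hR v]] at h
    simpa using h v (Finset.mem_univ v)
  -- The indices are drawn from `w`; given them, `u` and `v` are conditionally independent.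
  refine ⟨fun u v => w (f u) (g v) * (P u / p' (f u)) * (R v / q' (g v)),
    ⟨fun u v => ?_, fun u => ?_, fun v => ?_⟩, fun h h0 h1 => ?_⟩
  · exact mul_nonneg (mul_nonneg (hw.1 _ _) (div_nonneg (hP u) (hp' _))) (div_nonneg (hR v) (hq' _))
  · rw [sum_disintegration R g (fun j => w (f u) j * (P u / p' (f u)))
      (fun j hj => by rw [hwq _ _ hj, zero_mul]), ← Finset.sum_mul, hw.2.1]
    by_cases h : p' (f u) = 0
    · rw [hPz u h, h]; simp
    · field_simp
  · have h1 : ∀ u, w (f u) (g v) * (P u / p' (f u)) * (R v / q' (g v)) =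
        (w (f u) (g v) * (R v / q' (g v))) * (P u / p' (f u)) := fun u => by ring
    simp only [h1]
    rw [sum_disintegration P f (fun i => w i (g v) * (R v / q' (g v)))
      (fun i hi => by rw [hwp _ _ hi, zero_mul]), ← Finset.sum_mul, hw.2.2]
    by_cases h : q' (g v) = 0
    · rw [hRz v h, h]; simp
    · field_simp
  · refine le_of_eq_of_le ?_ (hwh h h0 h1)
    have e1 : ∀ u, ∑ v, w (f u) (g v) * (P u / p' (f u)) * (R v / q' (g v)) * h (f u) (g v) =
        (∑ j, w (f u) j * h (f u) j) * (P u / p' (f u)) := by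
      intro u
      have e : ∀ v, w (f u) (g v) * (P u / p' (f u)) * (R v / q' (g v)) * h (f u) (g v) =
        (w (f u) (g v) * h (f u) (g v) * (P u / p' (f u))) * (R v / q' (g v)) := fun v => by ring
      simp only [e]
      rw [sum_disintegration R g (fun j => w (f u) j * h (f u) j * (P u / p' (f u)))
        (fun j hj => by rw [hwq _ _ hj, zero_mul, zero_mul]), ← Finset.sum_mul]
    simp only [e1]
    exact sum_disintegration P f (fun i => ∑ j, w i j * h i j)
      fun i hi => Finset.sum_eq_zero fun j _ => by rw [hwp _ _ hi, zero_mul]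

end Gluing

/-! ### Central limit theorem for empirical distributions -/

section CentralLimit

variable {A : Type*} [Fintype A] [DecidableEq A]

theorem inner_fluctuation (p : A → ℝ) {n : ℕ} (hn : 0 < n) (x : Fin n → A)
    (t : EuclideanSpace ℝ A) :
    inner ℝ (WithLp.toLp 2 (fluctuation p x)) t =
      (√(n : ℝ))⁻¹ * (∑ i, t (x i) - n * ∑ a, p a * t a) := by
  have hs : 0 < √(n : ℝ) := Real.sqrt_pos.2 (by exact_mod_cast hn)
  rw [sum_comp_eq_empirical hn x fun a => t a, ← mul_sub, ← Finset.sum_sub_distrib, ← mul_assoc]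
  have h : (√(n : ℝ))⁻¹ * n = √(n : ℝ) := by
    rw [inv_mul_eq_div, div_eq_iff hs.ne', Real.mul_self_sqrt (Nat.cast_nonneg n)]
  rw [h, Finset.mul_sum]
  simp only [PiLp.inner_apply, fluctuation]
  refine Finset.sum_congr rfl fun a _ => ?_
  simp
  ring

variable [MeasurableSpace A] [MeasurableSingletonClass A]

/-- The law of the fluctuation of the empirical distribution of an i.i.d. sample. -/
noncomputable def fluctuationLaw (P : Measure A) [IsProbabilityMeasure P] (n : ℕ) :
    ProbabilityMeasure (EuclideanSpace ℝ A) :=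
  ⟨(Measure.pi fun _ : Fin n => P).map
    fun x => WithLp.toLp 2 (fluctuation (fun a => P.real {a}) x),
    Measure.isProbabilityMeasure_map Measurable.of_discrete.aemeasurable⟩

theorem variance_of_fintype (P : Measure A) [IsProbabilityMeasure P] (t : A → ℝ) :
    Var[t; P] = t ⬝ᵥ (indicatorCov P).mulVec t := by
  rw [variance_eq_sub (MemLp.of_discrete), integral_fintype Integrable.of_finite,
    integral_fintype Integrable.of_finite]
  simp only [indicatorCov, Matrix.mulVec, dotProduct, Matrix.of_apply, sub_mul, ite_mul, zero_mul,
    Finset.sum_sub_distrib, Finset.sum_ite_eq, Finset.mem_univ, if_true, mul_sub, smul_eq_mul,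
    Pi.pow_apply]
  congr 1
  · exact Finset.sum_congr rfl fun a _ => by ring
  · rw [pow_two, Finset.sum_mul]
    refine Finset.sum_congr rfl fun a _ => ?_
    rw [Finset.mul_sum, Finset.mul_sum]
    exact Finset.sum_congr rfl fun b _ => by ring

/-- `gaussLaw P` as a probability measure. -/
noncomputable def gaussProb (P : Measure A) : ProbabilityMeasure (EuclideanSpace ℝ A) :=
  ⟨gaussLaw P, by unfold gaussLaw; infer_instance⟩

/-- Cramér–Wold: the characteristic function at `t` is that of a normalized i.i.d. sum of `t (x i)`
at `1`, so the scalar theorem applies. Its limiting variance is the quadratic form of `indicatorCov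
P` at `t`. -/
theorem tendsto_fluctuationLaw (P : Measure A) [IsProbabilityMeasure P] :
    Tendsto (fluctuationLaw P) atTop (𝓝 (gaussProb P)) := by
  refine ProbabilityMeasure.tendsto_iff_tendsto_charFun.2 fun t => ?_
  set m : ℝ := ∑ a, P.real {a} * t a with hm
  -- The scalar theorem needs one infinite i.i.d. sequence; its first `n` coordinates have the
  -- finite product law.
  let Q : Measure (ℕ → A) := Measure.infinitePi fun _ => P
  let X : ℕ → (ℕ → A) → ℝ := fun k ω => t (ω k)
  have hX : ∀ k, Measurable (X k) := fun k =>
    (Measurable.of_discrete (f := fun a : A => t a)).comp (measurable_pi_apply k)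
  have hev : ∀ k, Q.map (fun ω => ω k) = P := fun k => Measure.infinitePi_map_eval _ k
  have hlaw : ∀ k, Q.map (X k) = P.map fun a => t a := by
    intro k
    rw [← hev k]
    exact (Measure.map_map Measurable.of_discrete (measurable_pi_apply k)).symm
  have hid : ∀ k, IdentDistrib (X k) (X 0) Q Q := fun k =>
    ⟨(hX k).aemeasurable, (hX 0).aemeasurable, by rw [hlaw, hlaw]⟩
  have hind : iIndepFun X Q :=
    iIndepFun_infinitePi (P := fun _ : ℕ => P) (X := fun _ a => t a) fun _ => Measurable.of_discrete
  have hL2 : MemLp (X 0) 2 Q := by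
    have h : MemLp (fun a : A => t a) 2 (Q.map fun ω => ω 0) := MemLp.of_discrete
    exact h.comp_of_map (measurable_pi_apply 0).aemeasurable
  have hmean : Q[X 0] = m := by
    have h : ∫ ω, X 0 ω ∂Q = ∫ a, t a ∂(Q.map fun ω => ω 0) :=
      (integral_map (measurable_pi_apply 0).aemeasurable
        Measurable.of_discrete.aestronglyMeasurable).symm
    rw [h, hev, integral_fintype Integrable.of_finite]
    simp [hm]
  have hvar : Var[X 0; Q] = t ⬝ᵥ (indicatorCov P).mulVec t := by
    have h : Var[fun a : A => t a; Q.map fun ω => ω 0] = Var[X 0; Q] :=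
      variance_map Measurable.of_discrete.aemeasurable (measurable_pi_apply 0).aemeasurable
    rw [← h, hev]
    exact variance_of_fintype P t
  have hclt := (tendstoInDistribution_inv_sqrt_mul_sum_sub (P := Q) (X := X)
    (Y := id) (P' := gaussianReal 0 Var[X 0; Q].toNNReal)
    ⟨aemeasurable_id, Measure.map_id⟩ hL2 hind hid).tendsto
  have h1 := ProbabilityMeasure.tendsto_iff_tendsto_charFun.1 hclt 1
  have hlim : charFun (gaussProb P : Measure (EuclideanSpace ℝ A)) t =
      charFun ((gaussianReal 0 Var[X 0; Q].toNNReal).map id) 1 := by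
    rw [Measure.map_id, charFun_gaussianReal]
    show charFun (multivariateGaussian 0 (indicatorCov P)) t = _
    rw [charFun_multivariateGaussian (indicatorCov_posSemidef P), ← hvar]
    simp [variance_nonneg]
  rw [hlim]
  refine h1.congr' ?_
  filter_upwards [eventually_gt_atTop 0] with n hn
  have hrest : Q.map (fun ω (i : Fin n) => ω i) = Measure.pi fun _ : Fin n => P := by
    have hi : iIndepFun (fun (k : ℕ) (ω : ℕ → A) => ω k) Q :=
      iIndepFun_infinitePi (P := fun _ : ℕ => P) (X := fun _ a => a) fun _ => measurable_id
    have := (hi.precomp (Fin.val_injective (n := n))).map_fun_eq_pi_map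
      (fun i => (measurable_pi_apply _).aemeasurable)
    simp only [hev] at this
    exact this
  show charFun (Q.map fun ω => (√(n : ℝ))⁻¹ * (∑ k ∈ Finset.range n, X k ω - n * Q[X 0])) 1 =
    charFun ((Measure.pi fun _ : Fin n => P).map
      fun x => WithLp.toLp 2 (fluctuation (fun a => P.real {a}) x)) t
  rw [charFun_apply, charFun_apply, ← hrest,
    Measure.map_map Measurable.of_discrete (by fun_prop),
    integral_map (by fun_prop) (by fun_prop), integral_map ?_ (by fun_prop)]
  · refine integral_congr_ae (Eventually.of_forall fun ω => ?_)
    simp only [Function.comp_apply]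
    rw [inner_fluctuation _ hn, hmean, ← hm, Finset.sum_range]
    simp [X]
  · exact (Measurable.of_discrete.comp (by fun_prop)).aemeasurable

/-- For `n > 0` the fluctuations lie almost surely in this closed set, so by the portmanteau theorem
the Gaussian limit does too. -/
theorem ae_mem_perturbations (P : Measure A) [IsProbabilityMeasure P] :
    ∀ᵐ b ∂(gaussLaw P), (fun a => b a) ∈ perturbations fun a => P.real {a} := by
  have hp1 : ∑ a, P.real {a} = 1 := by rw [sum_measureReal_singleton]; simp
  set F : Set (EuclideanSpace ℝ A) := {b | (fun a => b a) ∈ perturbations fun a => P.real {a}}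
    with hF
  have hFc : IsClosed F := isClosed_perturbations.preimage (by fun_prop)
  have hone : ∀ᶠ n in atTop, (fluctuationLaw P n : Measure (EuclideanSpace ℝ A)) F = 1 := by
    filter_upwards [eventually_gt_atTop 0] with n hn
    rw [prob_compl_eq_zero_iff hFc.measurableSet |>.symm]
    show ((Measure.pi fun _ : Fin n => P).map
      fun x => WithLp.toLp 2 (fluctuation (fun a => P.real {a}) x)) Fᶜ = 0
    rw [Measure.map_apply Measurable.of_discrete hFc.measurableSet.compl]
    have h1 : ∀ᵐ a ∂P, P.real {a} ≠ 0 := by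
      rw [ae_iff_of_countable]
      exact fun a ha => (ENNReal.toReal_pos ha (measure_ne_top _ _)).ne'
    have h2 : ∀ᵐ x ∂(Measure.pi fun _ : Fin n => P), ∀ i, P.real {x i} ≠ 0 :=
      ae_all_iff.2 fun i =>
        (measurePreserving_eval (fun _ : Fin n => P) i).quasiMeasurePreserving.ae h1
    refine measure_mono_null (fun x hx => ?_) h2
    simp only [hF, Set.mem_preimage, Set.mem_compl_iff, Set.mem_ofPred_eq] at hx ⊢
    exact fun h => hx ((fluctuation_mem_perturbations_iff hn hp1 x).2 h)
  have hle := ProbabilityMeasure.limsup_measure_closed_le_of_tendsto (tendsto_fluctuationLaw P) hFc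
  have hlim : limsup (fun n => (fluctuationLaw P n : Measure (EuclideanSpace ℝ A)) F) atTop = 1 := by
    rw [limsup_congr hone, limsup_const]
  rw [hlim] at hle
  have : IsProbabilityMeasure (gaussLaw P) := (gaussProb P).2
  rw [ae_iff]
  exact (prob_compl_eq_zero_iff hFc.measurableSet).2 (le_antisymm prob_le_one hle)

end CentralLimit

/-! ### Weak compactness of couplings -/

section Compactness

/-- A convergent sequence together with its limit is compact, and the converse half of Prokhorov's
theorem applies. -/
theorem isTightMeasureSet_range_of_tendsto {E : Type*} [MetricSpace E] [SecondCountableTopology E]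
    [CompleteSpace E] [MeasurableSpace E] [BorelSpace E] {μ : ℕ → ProbabilityMeasure E}
    {μ₀ : ProbabilityMeasure E} (h : Tendsto μ atTop (𝓝 μ₀)) :
    IsTightMeasureSet {((m : ProbabilityMeasure E) : Measure E) | m ∈ Set.range μ} :=
  isTightMeasureSet_of_isCompact_closure
    (h.isCompact_insert_range.closure_of_subset (Set.subset_insert _ _))

variable {E F : Type*} [MetricSpace E] [SecondCountableTopology E] [CompleteSpace E]
  [MeasurableSpace E] [BorelSpace E] [MetricSpace F] [SecondCountableTopology F] [CompleteSpace F]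
  [MeasurableSpace F] [BorelSpace F]

/-- Couplings of convergent sequences of laws have a convergent subsequence. -/
theorem exists_tendsto_coupling {μ : ℕ → ProbabilityMeasure E} {μ₀ : ProbabilityMeasure E}
    (hμ : Tendsto μ atTop (𝓝 μ₀)) {ν : ℕ → ProbabilityMeasure F} {ν₀ : ProbabilityMeasure F}
    (hν : Tendsto ν atTop (𝓝 ν₀)) {φ : ℕ → ℕ} (hφ : StrictMono φ)
    {π : ℕ → ProbabilityMeasure (E × F)}
    (hπ : ∀ k, (π k : Measure (E × F)) ∈ couplings (μ (φ k) : Measure E) (ν (φ k) : Measure F)) :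
    ∃ π₀ : ProbabilityMeasure (E × F), (π₀ : Measure (E × F)) ∈ couplings (μ₀ : Measure E) ν₀ ∧
      ∃ ψ : ℕ → ℕ, StrictMono ψ ∧ Tendsto (π ∘ ψ) atTop (𝓝 π₀) := by
  have htight : IsTightMeasureSet
      {((m : ProbabilityMeasure (E × F)) : Measure (E × F)) | m ∈ Set.range π} := by
    refine IsTightMeasureSet.prodMk ?_ ?_
    · refine (isTightMeasureSet_range_of_tendsto hμ).subset ?_
      rintro _ ⟨_, ⟨_, ⟨k, rfl⟩, rfl⟩, rfl⟩
      exact ⟨μ (φ k), ⟨_, rfl⟩, (hπ k).1.symm⟩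
    · refine (isTightMeasureSet_range_of_tendsto hν).subset ?_
      rintro _ ⟨_, ⟨_, ⟨k, rfl⟩, rfl⟩, rfl⟩
      exact ⟨ν (φ k), ⟨_, rfl⟩, (hπ k).2.symm⟩
  obtain ⟨π₀, -, ψ, hψ, hlim⟩ := (isCompact_closure_of_isTightMeasureSet htight).isSeqCompact
    fun k => subset_closure (Set.mem_range_self k)
  have hsub := (hφ.comp hψ).tendsto_atTop
  refine ⟨π₀, ⟨?_, ?_⟩, ψ, hψ, hlim⟩
  · have h1 := ProbabilityMeasure.tendsto_map_of_tendsto_of_continuous _ _ hlim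
      (continuous_fst (X := E) (Y := F))
    have h2 : ∀ k, (π (ψ k)).map (continuous_fst (X := E) (Y := F)).measurable.aemeasurable =
        μ (φ (ψ k)) := fun k => Subtype.ext (hπ (ψ k)).1
    simp only [Function.comp_apply, h2] at h1
    have h3 : π₀.map (continuous_fst (X := E) (Y := F)).measurable.aemeasurable = μ₀ :=
      tendsto_nhds_unique h1 (hμ.comp hsub)
    exact congrArg ProbabilityMeasure.toMeasure h3
  · have h1 := ProbabilityMeasure.tendsto_map_of_tendsto_of_continuous _ _ hlim
      (continuous_snd (X := E) (Y := F))
    have h2 : ∀ k, (π (ψ k)).map (continuous_snd (X := E) (Y := F)).measurable.aemeasurable =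
        ν (φ (ψ k)) := fun k => Subtype.ext (hπ (ψ k)).2
    simp only [Function.comp_apply, h2] at h1
    have h3 : π₀.map (continuous_snd (X := E) (Y := F)).measurable.aemeasurable = ν₀ :=
      tendsto_nhds_unique h1 (hν.comp hsub)
    exact congrArg ProbabilityMeasure.toMeasure h3

/-- Lower semicontinuity of Strassen's problem for increasing open sets. -/
theorem iInf_couplings_le_liminf {μ : ℕ → ProbabilityMeasure E} {μ₀ : ProbabilityMeasure E}
    (hμ : Tendsto μ atTop (𝓝 μ₀)) {ν : ℕ → ProbabilityMeasure F} {ν₀ : ProbabilityMeasure F}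
    (hν : Tendsto ν atTop (𝓝 ν₀)) {U : ℕ → Set (E × F)} (hU : ∀ n, IsOpen (U n))
    (hmono : Monotone U) :
    (⨅ π ∈ couplings (μ₀ : Measure E) (ν₀ : Measure F), π (⋃ n, U n)) ≤
      liminf (fun n => ⨅ π ∈ couplings (μ n : Measure E) (ν n : Measure F), π (U n)) atTop := by
  by_contra hcon
  obtain ⟨r, hr1, hr2⟩ := exists_between (not_le.1 hcon)
  obtain ⟨φ, hφ, hlt⟩ := extraction_of_frequently_atTop (frequently_lt_of_liminf_lt (by isBoundedDefault) hr1)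
  have hex : ∀ k, ∃ π : ProbabilityMeasure (E × F),
      (π : Measure (E × F)) ∈ couplings (μ (φ k) : Measure E) (ν (φ k) : Measure F) ∧
        (π : Measure (E × F)) (U (φ k)) < r := by
    intro k
    have := hlt k
    simp only [iInf_lt_iff] at this
    obtain ⟨π, hπ, h⟩ := this
    exact ⟨⟨π, isProbabilityMeasure_of_mem_couplings hπ⟩, hπ, h⟩
  choose π hπ hπr using hex
  obtain ⟨π₀, hπ₀, ψ, hψ, hlim⟩ := exists_tendsto_coupling hμ hν hφ hπ
  -- With `k` fixed, `U k` lies in all later sets, so the portmanteau bound for this single open set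
  -- suffices.
  have hle : ∀ k, (π₀ : Measure (E × F)) (U k) ≤ r := by
    intro k
    refine (ProbabilityMeasure.le_liminf_measure_open_of_tendsto hlim (hU k)).trans ?_
    refine liminf_le_of_frequently_le' (Eventually.frequently ?_)
    filter_upwards [eventually_ge_atTop k] with j hj
    refine (measure_mono (hmono ?_)).trans (hπr (ψ j)).le
    exact hj.trans ((hψ.id_le j).trans (hφ.id_le _))
  have h1 : (π₀ : Measure (E × F)) (⋃ n, U n) ≤ r := by
    rw [hmono.measure_iUnion]
    exact iSup_le hle
  exact absurd (hr2.trans_le (iInf₂_le _ hπ₀)) (not_lt.2 h1)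

end Compactness

/-! ### Lower bound and right-continuity -/

section LowerBound

variable {A B : Type*} [Fintype A] [MeasurableSpace A] [Fintype B] [MeasurableSpace B]

/-- The excess set of the cost `θ` in the product of Euclidean spaces. -/
def thetaExcess (c : A → B → ℝ≥0) (μ : Measure A) (ν : Measure B) (D : ℝ) :
    Set (EuclideanSpace ℝ A × EuclideanSpace ℝ B) :=
  {z | (D : EReal) < theta c μ ν (fun x => z.1 x) fun y => z.2 y}

variable (c : A → B → ℝ≥0) (μ : Measure A) (ν : Measure B)

theorem Lam_antitone [DecidableEq A] [DecidableEq B] : Antitone (Lam c μ ν) := fun _ _ h =>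
  iInf₂_mono fun _ _ => measure_mono fun _ hz => (EReal.coe_le_coe_iff.2 h).trans_lt hz

variable [MeasurableSingletonClass A] [MeasurableSingletonClass B]
  [IsProbabilityMeasure μ] [IsProbabilityMeasure ν]

theorem isOpen_thetaExcess (D : ℝ) : IsOpen (thetaExcess c μ ν D) :=
  (isOpen_lt_theta c μ ν D).preimage
    (f := fun z : EuclideanSpace ℝ A × EuclideanSpace ℝ B => (fun x => z.1 x, fun y => z.2 y))
    (by fun_prop)

variable [DecidableEq A] [DecidableEq B]

/-- The fluctuation maps push a coupling of the product laws to one of the fluctuation laws, and `θ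
> D` at the image forces excess cost at the source. Semicontinuity for one open set does the rest.
-/
theorem Lam_le_liminf (D : ℝ) :
    Lam c μ ν D ≤ liminf (fun n : ℕ =>
      productExcessProb c n ((otCost c μ ν).toReal + D / √(n : ℝ)) μ ν) atTop := by
  have h := iInf_couplings_le_liminf (tendsto_fluctuationLaw μ) (tendsto_fluctuationLaw ν)
    (fun _ => isOpen_thetaExcess c μ ν D) monotone_const
  rw [Set.iUnion_const] at h
  refine h.trans (liminf_le_liminf ?_)
  obtain ⟨Q, hQ, hmin, hα, hS⟩ := exists_optimal_table c μ ν
  filter_upwards [eventually_gt_atTop 0] with n hn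
  refine le_iInf₂ fun π hπ => ?_
  let f : (Fin n → A) → EuclideanSpace ℝ A :=
    fun x => WithLp.toLp 2 (fluctuation (fun a => μ.real {a}) x)
  let g : (Fin n → B) → EuclideanSpace ℝ B :=
    fun x => WithLp.toLp 2 (fluctuation (fun a => ν.real {a}) x)
  have hf : Measurable f := Measurable.of_discrete
  have hg : Measurable g := Measurable.of_discrete
  have hfg : Measurable (Prod.map f g) := hf.prodMap hg
  have hmem : π.map (Prod.map f g) ∈ couplings (fluctuationLaw μ n : Measure (EuclideanSpace ℝ A))
      (fluctuationLaw ν n : Measure (EuclideanSpace ℝ B)) := by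
    constructor
    · rw [Measure.map_map measurable_fst hfg]
      show π.map (f ∘ Prod.fst) = _
      rw [← Measure.map_map hf measurable_fst, hπ.1]; rfl
    · rw [Measure.map_map measurable_snd hfg]
      show π.map (g ∘ Prod.snd) = _
      rw [← Measure.map_map hg measurable_snd, hπ.2]; rfl
  refine (iInf₂_le _ hmem).trans ?_
  rw [Measure.map_apply hfg (isOpen_thetaExcess c μ ν D).measurableSet]
  refine measure_mono fun z hz => ?_
  have hs : 0 < √(n : ℝ) := Real.sqrt_pos.2 (by exact_mod_cast hn)
  simp only [Set.mem_ofPred_eq, EReal.coe_lt_coe_iff]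
  by_contra hle
  rw [not_lt] at hle
  obtain ⟨β, hβ, hcost⟩ := exists_signedCoupling_fluctuation (c := c) hn hQ (fun x y => (hS x y).1)
    z.1 z.2
  refine absurd ((theta_le_iff c μ ν _ _ D).2 ⟨β, hβ, ?_⟩) (not_le.2 hz)
  rw [hcost, ← hα]
  have := mul_le_mul_of_nonneg_left hle hs.le
  rw [mul_add, mul_div_cancel₀ _ hs.ne'] at this
  linarith

/-- By monotonicity the right limit is a supremum. The strict excess sets at `D + 1/(k+1)` increase
to the one at `D`, so compactness with constant laws bounds `Λ` by this supremum. -/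
theorem continuousWithinAt_Lam (D : ℝ) :
    ContinuousWithinAt (fun D' : ℝ => Lam c μ ν D') (Set.Ici D) D := by
  have hanti := Lam_antitone c μ ν
  rw [← continuousWithinAt_Ioi_iff_Ici]
  have h1 := hanti.tendsto_nhdsGT D
  suffices sSup (Lam c μ ν '' Set.Ioi D) = Lam c μ ν D by rw [this] at h1; exact h1
  refine le_antisymm (sSup_le ?_) ?_
  · rintro _ ⟨D', hD', rfl⟩
    exact hanti (le_of_lt hD')
  have hmono : Monotone fun k : ℕ => thetaExcess c μ ν (D + 1 / ((k : ℝ) + 1)) := by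
    intro k l hkl z hz
    refine lt_of_le_of_lt (EReal.coe_le_coe_iff.2 ?_) hz
    have := one_div_le_one_div_of_le (by positivity : (0 : ℝ) < (k : ℝ) + 1)
      (by exact_mod_cast Nat.succ_le_succ hkl : (k : ℝ) + 1 ≤ (l : ℝ) + 1)
    linarith
  have hU : ⋃ k : ℕ, thetaExcess c μ ν (D + 1 / ((k : ℝ) + 1)) = thetaExcess c μ ν D := by
    ext z
    simp only [Set.mem_iUnion]
    constructor
    · rintro ⟨k, hk⟩
      refine lt_of_le_of_lt (EReal.coe_le_coe_iff.2 ?_) hk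
      have : (0 : ℝ) < 1 / ((k : ℝ) + 1) := by positivity
      linarith
    · intro hz
      obtain ⟨r, hr1, hr2⟩ := EReal.lt_iff_exists_real_btwn.1 hz
      obtain ⟨k, hk⟩ := exists_nat_one_div_lt (sub_pos.2 (EReal.coe_lt_coe_iff.1 hr1))
      refine ⟨k, lt_of_le_of_lt (EReal.coe_le_coe_iff.2 ?_) hr2⟩
      linarith
  have h := iInf_couplings_le_liminf
    (tendsto_const_nhds (x := gaussProb μ) (f := (atTop : Filter ℕ)))
    (tendsto_const_nhds (x := gaussProb ν) (f := (atTop : Filter ℕ)))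
    (fun k => isOpen_thetaExcess c μ ν (D + 1 / ((k : ℝ) + 1))) hmono
  rw [hU] at h
  refine h.trans (liminf_le_of_frequently_le' (Eventually.frequently (Eventually.of_forall ?_)))
  intro k
  refine le_sSup ⟨D + 1 / ((k : ℝ) + 1), ?_, rfl⟩
  have : (0 : ℝ) < 1 / ((k : ℝ) + 1) := by positivity
  simp only [Set.mem_Ioi]; linarith

end LowerBound

/-! ### Finite partitions with null boundaries -/

section Partition

/-- A finite measurable partition with null boundaries, all of whose cells but the last one are
small and bounded, while the last one has small probability. -/
theorem exists_partition_null_frontier {E : Type*} [NormedAddCommGroup E]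
    [SecondCountableTopology E] [MeasurableSpace E] [BorelSpace E] (μ : Measure E)
    [IsProbabilityMeasure μ] {δ : ℝ} (hδ : 0 < δ) {ε : ℝ≥0∞} (hε : 0 < ε) :
    ∃ (N : ℕ) (f : E → Fin (N + 1)), Measurable f ∧ (∀ i, μ (frontier (f ⁻¹' {i})) = 0) ∧
      (∀ e e', f e = f e' → f e ≠ Fin.last N → dist e e' ≤ δ) ∧
      (∃ M : ℝ, ∀ e, f e ≠ Fin.last N → ‖e‖ ≤ M) ∧ μ (f ⁻¹' {Fin.last N}) < ε := by
  classical
  -- Radii above `δ / 4` let balls at dense centres cover the space, and radii below `δ / 2` bound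
  -- the diameters by `δ`.
  have hr : ∀ k : ℕ, ∃ r ∈ Set.Ioo (δ / 4) (δ / 2),
      μ (frontier (Metric.ball (TopologicalSpace.denseSeq E k) r)) = 0 := by
    intro k
    obtain ⟨r, hr, h⟩ := exists_null_frontier_thickening μ {TopologicalSpace.denseSeq E k}
      (by linarith : δ / 4 < δ / 2)
    exact ⟨r, hr, by rwa [Metric.thickening_singleton] at h⟩
  choose r hr hfr using hr
  set B : ℕ → Set E := fun k => Metric.ball (TopologicalSpace.denseSeq E k) (r k) with hB
  have hcov : ∀ e, ∃ k, e ∈ B k := by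
    intro e
    obtain ⟨k, hk⟩ := (TopologicalSpace.denseRange_denseSeq E).exists_dist_lt e
      (by linarith : 0 < δ / 4)
    exact ⟨k, Metric.mem_ball.2 (hk.trans (hr k).1)⟩
  have hrest : Tendsto (fun N : ℕ => μ {e | ∀ j < N, e ∉ B j}) atTop (𝓝 0) := by
    have hmeas : ∀ N : ℕ, MeasurableSet {e | ∀ j < N, e ∉ B j} := by
      intro N
      have : {e | ∀ j < N, e ∉ B j} = ⋂ j, ⋂ _ : j < N, (B j)ᶜ := by ext; simp
      rw [this]
      exact MeasurableSet.iInter fun j => MeasurableSet.iInter fun _ =>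
        Metric.isOpen_ball.measurableSet.compl
    have h := tendsto_measure_iInter_atTop (μ := μ) (fun N => (hmeas N).nullMeasurableSet)
      (fun N N' h e he j hj => he j (hj.trans_le h)) ⟨0, measure_ne_top _ _⟩
    have h0 : ⋂ N : ℕ, {e | ∀ j < N, e ∉ B j} = ∅ := by
      ext e
      simp only [Set.mem_iInter, Set.mem_ofPred_eq, Set.mem_empty_iff_false, iff_false]
      intro h
      obtain ⟨k, hk⟩ := hcov e
      exact h (k + 1) k (Nat.lt_succ_self k) hk
    rwa [h0, measure_empty] at h
  obtain ⟨N, hN⟩ := (hrest.eventually (gt_mem_nhds hε)).exists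
  -- With the whole space at index `N`, the cell of a point is the first index of a set containing
  -- it; the last cell is what the first `N` balls miss.
  set B' : ℕ → Set E := fun k => if k < N then B k else Set.univ with hB'
  have hB'N : ∀ e, ∃ k, e ∈ B' k := fun e => ⟨N, by simp [hB']⟩
  have hfindle : ∀ e, Nat.find (hB'N e) < N + 1 := fun e =>
    Nat.lt_succ_of_le (Nat.find_le (by simp [hB']))
  let f : E → Fin (N + 1) := fun e => ⟨Nat.find (hB'N e), hfindle e⟩
  have hfiber : ∀ i : Fin (N + 1), f ⁻¹' {i} = B' i ∩ {e | ∀ j < (i : ℕ), e ∉ B' j} := by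
    intro i
    ext e
    simp only [f, Set.mem_preimage, Set.mem_singleton_iff, Fin.ext_iff, Nat.find_eq_iff]
    rfl
  have hB'fr : ∀ k, μ (frontier (B' k)) = 0 := by
    intro k
    by_cases hk : k < N
    · simp only [hB', hk, if_true]; exact hfr k
    · simp [hB', hk]
  have hB'meas : ∀ k, MeasurableSet (B' k) := by
    intro k
    by_cases hk : k < N
    · simp only [hB', hk, if_true]; exact Metric.isOpen_ball.measurableSet
    · simp [hB', hk]
  have hinter : ∀ s t : Set E, μ (frontier s) = 0 → μ (frontier t) = 0 →
      μ (frontier (s ∩ t)) = 0 := fun s t hs ht =>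
    measure_mono_null ((frontier_inter_subset s t).trans (Set.union_subset_union
      Set.inter_subset_left Set.inter_subset_right)) (measure_union_null hs ht)
  have hC : ∀ m : ℕ, μ (frontier {e | ∀ j < m, e ∉ B' j}) = 0 ∧
      MeasurableSet {e | ∀ j < m, e ∉ B' j} := by
    intro m
    induction m with
    | zero => simp
    | succ m ih =>
      have : {e | ∀ j < m + 1, e ∉ B' j} = {e | ∀ j < m, e ∉ B' j} ∩ (B' m)ᶜ := by
        ext e
        simp only [Set.mem_ofPred_eq, Set.mem_inter_iff, Set.mem_compl_iff, Nat.lt_succ_iff_lt_or_eq]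
        constructor
        · exact fun h => ⟨fun j hj => h j (Or.inl hj), h m (Or.inr rfl)⟩
        · rintro ⟨h1, h2⟩ j (hj | rfl)
          · exact h1 j hj
          · exact h2
      rw [this]
      exact ⟨hinter _ _ ih.1 (by rw [frontier_compl]; exact hB'fr m), ih.2.inter (hB'meas m).compl⟩
  have hball : ∀ e, f e ≠ Fin.last N → (f e : ℕ) < N ∧ e ∈ B (f e) := by
    intro e he
    have h1 : (f e : ℕ) < N := lt_of_le_of_ne (Nat.lt_succ_iff.1 (f e).2)
      fun h => he (Fin.ext h)
    have h2 : e ∈ B' (f e) := Nat.find_spec (hB'N e)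
    simp only [hB', h1, if_true] at h2
    exact ⟨h1, h2⟩
  refine ⟨N, f, measurable_to_countable' fun i => ?_, fun i => ?_, fun e e' h he => ?_, ?_, ?_⟩
  · rw [hfiber]; exact (hB'meas _).inter (hC _).2
  · rw [hfiber]; exact hinter _ _ (hB'fr _) (hC _).1
  · have h1 := (hball e he).2
    have h2 := (hball e' (h ▸ he)).2
    rw [← h] at h2
    have h3 := dist_triangle_right e e' (TopologicalSpace.denseSeq E (f e))
    have h4 := (hr (f e)).2
    rw [hB, Metric.mem_ball] at h1 h2
    linarith
  · refine ⟨∑ k ∈ Finset.range N, (‖TopologicalSpace.denseSeq E k‖ + r k), fun e he => ?_⟩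
    obtain ⟨h1, h2⟩ := hball e he
    have h3 : ‖e‖ ≤ ‖TopologicalSpace.denseSeq E (f e)‖ + r (f e) := by
      rw [hB, Metric.mem_ball, dist_eq_norm] at h2
      have := norm_le_norm_add_norm_sub' e (TopologicalSpace.denseSeq E (f e))
      linarith
    refine h3.trans (Finset.single_le_sum
      (f := fun k => ‖TopologicalSpace.denseSeq E k‖ + r k) (fun k _ => ?_)
      (Finset.mem_range.2 h1))
    have := (hr k).1
    have := norm_nonneg (TopologicalSpace.denseSeq E k)
    linarith
  · refine lt_of_le_of_lt (measure_mono fun e he => ?_) hN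
    rw [hfiber] at he
    intro j hj
    have := he.2 j (by simpa using hj)
    simpa only [hB', hj, if_true] using this

theorem sum_ite_measureReal_singleton {Z : Type*} [Fintype Z] [MeasurableSpace Z]
    [MeasurableSingletonClass Z] (ρ : Measure Z) [IsFiniteMeasure ρ] (s : Set Z)
    [DecidablePred (· ∈ s)] : ∑ z, (if z ∈ s then ρ.real {z} else 0) = ρ.real s := by
  rw [← Finset.sum_filter, sum_measureReal_singleton]
  congr 1
  ext z; simp

end Partition

/-! ### Upper bound by discretization -/

section UpperBound

theorem ne_zero_of_pi_real_singleton_pos {A : Type*} [MeasurableSpace A] {P : Measure A} [IsProbabilityMeasure P] {n : ℕ}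
    {u : Fin n → A} (hu : (Measure.pi fun _ : Fin n => P).real {u} ≠ 0) (i : Fin n) :
    P.real {u i} ≠ 0 := by
  intro h
  apply hu
  rw [measureReal_def, Measure.pi_singleton, Finset.prod_eq_zero (Finset.mem_univ i),
    ENNReal.toReal_zero]
  rwa [measureReal_def, ENNReal.toReal_eq_zero_iff, or_iff_left (measure_ne_top _ _)] at h

theorem norm_toLp_le {A : Type*} [Fintype A] {b : A → ℝ} {M : ℝ} (hM : 0 ≤ M)
    (h : ‖(WithLp.toLp 2 b : EuclideanSpace ℝ A)‖ ≤ M) : ‖b‖ ≤ M :=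
  (pi_norm_le_iff_of_nonneg hM).2 fun a =>
    (PiLp.norm_apply_le (WithLp.toLp 2 b : EuclideanSpace ℝ A) a).trans h

variable {A B : Type*} [Fintype A] [DecidableEq A] [MeasurableSpace A] [MeasurableSingletonClass A]
  [Fintype B] [DecidableEq B] [MeasurableSpace B] [MeasurableSingletonClass B]

theorem sum_ite_fluctuation (P : Measure A) [IsProbabilityMeasure P] (n : ℕ) {N : ℕ}
    {f : EuclideanSpace ℝ A → Fin (N + 1)} (hf : Measurable f) (i : Fin (N + 1)) :
    (∑ u : Fin n → A, if f (WithLp.toLp 2 (fluctuation (fun a => P.real {a}) u)) = i then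
      (Measure.pi fun _ : Fin n => P).real {u} else 0) =
        (fluctuationLaw P n : Measure (EuclideanSpace ℝ A)).real (f ⁻¹' {i}) := by
  classical
  rw [fluctuationLaw]
  dsimp only [ProbabilityMeasure.coe_mk]
  rw [map_measureReal_apply Measurable.of_discrete (hf (measurableSet_singleton i)),
    ← sum_ite_measureReal_singleton]
  exact Finset.sum_congr rfl fun u _ => if_congr Iff.rfl rfl rfl

/-- The total deficit of the laws of the fluctuations on a partition with null boundaries vanishes
in the limit. -/
theorem tendsto_deficit (P : Measure A) [IsProbabilityMeasure P] {N : ℕ}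
    {f : EuclideanSpace ℝ A → Fin (N + 1)} (hfm : Measurable f)
    (hf : ∀ i, gaussLaw P (frontier (f ⁻¹' {i})) = 0) :
    Tendsto (fun n : ℕ => ∑ i, max (((gaussLaw P).map f).real {i} -
      ∑ u : Fin n → A, if f (WithLp.toLp 2 (fluctuation (fun a => P.real {a}) u)) = i then
        (Measure.pi fun _ : Fin n => P).real {u} else 0) 0) atTop (𝓝 0) := by
  have hG : IsProbabilityMeasure (gaussLaw P) := (gaussProb P).2
  have h : ∀ i ∈ (Finset.univ : Finset (Fin (N + 1))), Tendsto (fun n : ℕ =>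
      max (((gaussLaw P).map f).real {i} -
        ∑ u : Fin n → A, if f (WithLp.toLp 2 (fluctuation (fun a => P.real {a}) u)) = i then
          (Measure.pi fun _ : Fin n => P).real {u} else 0) 0) atTop (𝓝 0) := by
    intro i _
    simp only [sum_ite_fluctuation P _ hfm]
    rw [map_measureReal_apply hfm (measurableSet_singleton i)]
    have h1 := ProbabilityMeasure.tendsto_measure_of_null_frontier_of_tendsto'
      (tendsto_fluctuationLaw P) (hf i)
    have h2 := ((ENNReal.tendsto_toReal (measure_ne_top _ _)).comp h1).const_sub
      ((gaussLaw P).real (f ⁻¹' {i}))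
    have h3 := h2.max (tendsto_const_nhds (x := (0 : ℝ)))
    have h4 : max ((gaussLaw P).real (f ⁻¹' {i}) -
      ((gaussProb P : Measure (EuclideanSpace ℝ A)) (f ⁻¹' {i})).toReal) 0 = 0 := by
      have : (gaussProb P : Measure (EuclideanSpace ℝ A)) = gaussLaw P := rfl
      rw [this, measureReal_def, sub_self, max_self]
    rw [h4] at h3
    exact h3
  simpa using tendsto_finsetSum _ h

variable (c : A → B → ℝ≥0) (μ : Measure A) (ν : Measure B) [IsProbabilityMeasure μ]
  [IsProbabilityMeasure ν]

theorem eventually_productExcessProb_le {D D' : ℝ} (hD : D' < D)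
    {Ψ : Measure (EuclideanSpace ℝ A × EuclideanSpace ℝ B)}
    (hΨ : Ψ ∈ couplings (gaussLaw μ) (gaussLaw ν)) {ε : ℝ} (hε : 0 < ε) :
    ∀ᶠ n : ℕ in atTop, productExcessProb c n ((otCost c μ ν).toReal + D / √(n : ℝ)) μ ν ≤
      Ψ (thetaExcess c μ ν D') + ENNReal.ofReal (4 * ε) := by
  classical
  have hGμ : IsProbabilityMeasure (gaussLaw μ) := (gaussProb μ).2
  have hGν : IsProbabilityMeasure (gaussLaw ν) := (gaussProb ν).2
  have hΨp : IsProbabilityMeasure Ψ := isProbabilityMeasure_of_mem_couplings hΨ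
  have hp1 : ∑ a, μ.real {a} = 1 := by rw [sum_measureReal_singleton]; simp
  have hq1 : ∑ a, ν.real {a} = 1 := by rw [sum_measureReal_singleton]; simp
  obtain ⟨Q, hQ, hmin, hα, hS⟩ := exists_optimal_table c μ ν
  obtain ⟨K, hK0, hK⟩ := exists_signedCoupling_lipschitz hQ hmin hS hp1 hq1
  -- Cells so small that the Lipschitz constant `K` costs at most `D - D'`; the summand `1` covers
  -- `K = 0`.
  have hδ : 0 < (D - D') / (K + 1) := div_pos (sub_pos.2 hD) (by linarith)
  set δ := (D - D') / (K + 1) with hδdef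
  have hKδ : K * δ ≤ D - D' := by
    rw [hδdef, mul_div_assoc', div_le_iff₀ (by linarith)]
    nlinarith [sub_pos.2 hD]
  have hε' : 0 < ENNReal.ofReal ε := ENNReal.ofReal_pos.2 hε
  obtain ⟨N, f, hfm, hfr, hfd, ⟨M₁, hM₁⟩, hfl⟩ := exists_partition_null_frontier (gaussLaw μ) hδ hε'
  obtain ⟨N', g, hgm, hgr, hgd, ⟨M₂, hM₂⟩, hgl⟩ := exists_partition_null_frontier (gaussLaw ν) hδ hε'
  have hfgm : Measurable (Prod.map f g) := hfm.prodMap hgm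
  have hρ : Ψ.map (Prod.map f g) ∈ couplings ((gaussLaw μ).map f) ((gaussLaw ν).map g) := by
    constructor
    · rw [Measure.map_map measurable_fst hfgm, ← hΨ.1, Measure.map_map hfm measurable_fst]; rfl
    · rw [Measure.map_map measurable_snd hfgm, ← hΨ.2, Measure.map_map hgm measurable_snd]; rfl
  have hμf : IsProbabilityMeasure ((gaussLaw μ).map f) :=
    Measure.isProbabilityMeasure_map hfm.aemeasurable
  have hψ := couplings_real_mem_tables hρ
  have hρp : IsProbabilityMeasure (Ψ.map (Prod.map f g)) :=
    isProbabilityMeasure_of_mem_couplings hρ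
  have hψ1 : ∑ i, ((gaussLaw μ).map f).real {i} = 1 := by rw [sum_measureReal_singleton]; simp
  -- the pairs of cells that contain a feasible pair of small cost
  set good : Set (Fin (N + 1) × Fin (N' + 1)) := {k | k.1 ≠ Fin.last N ∧ k.2 ≠ Fin.last N' ∧
    ∃ (e : EuclideanSpace ℝ A) (e' : EuclideanSpace ℝ B), f e = k.1 ∧ g e' = k.2 ∧
      (fun a => e a) ∈ perturbations (fun a => μ.real {a}) ∧
      (fun b => e' b) ∈ perturbations (fun b => ν.real {b}) ∧
      theta c μ ν (fun a => e a) (fun b => e' b) ≤ D'} with hgood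
  have hbadΨ : ∑ i, ∑ j, (Ψ.map (Prod.map f g)).real {(i, j)} *
      (if (i, j) ∈ goodᶜ then (1 : ℝ) else 0) ≤ Ψ.real (thetaExcess c μ ν D') + 2 * ε := by
    simp only [mul_ite, mul_one, mul_zero]
    rw [← Fintype.sum_prod_type' fun i j =>
      if (i, j) ∈ goodᶜ then (Ψ.map (Prod.map f g)).real {(i, j)} else 0]
    simp only [Prod.mk.eta]
    rw [sum_ite_measureReal_singleton, map_measureReal_apply hfgm (Set.toFinite _).measurableSet]
    -- An admissible point with `θ ≤ D'` outside both last cells would itself witness that its cell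
    -- is good.
    have hsub : ∀ᵐ z ∂Ψ, z ∈ Prod.map f g ⁻¹' goodᶜ → z ∈ thetaExcess c μ ν D' ∪
        (Prod.fst ⁻¹' (f ⁻¹' {Fin.last N}) ∪ Prod.snd ⁻¹' (g ⁻¹' {Fin.last N'})) := by
      have h1 : ∀ᵐ z ∂Ψ, (fun a => z.1 a) ∈ perturbations (fun a => μ.real {a}) :=
        ae_of_ae_map measurable_fst.aemeasurable (by rw [hΨ.1]; exact ae_mem_perturbations μ)
      have h2 : ∀ᵐ z ∂Ψ, (fun a => z.2 a) ∈ perturbations (fun a => ν.real {a}) :=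
        ae_of_ae_map measurable_snd.aemeasurable (by rw [hΨ.2]; exact ae_mem_perturbations ν)
      filter_upwards [h1, h2] with z hz1 hz2 hz
      by_contra hcon
      simp only [Set.mem_union, Set.mem_preimage, Set.mem_singleton_iff, not_or] at hcon
      exact hz ⟨hcon.2.1, hcon.2.2, z.1, z.2, rfl, rfl, hz1, hz2, not_lt.1 hcon.1⟩
    have h1 : Ψ.real (Prod.map f g ⁻¹' goodᶜ) ≤ Ψ.real (thetaExcess c μ ν D' ∪
        (Prod.fst ⁻¹' (f ⁻¹' {Fin.last N}) ∪ Prod.snd ⁻¹' (g ⁻¹' {Fin.last N'}))) :=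
      ENNReal.toReal_mono (measure_ne_top _ _) (measure_mono_ae hsub)
    have h2 : Ψ.real (Prod.fst ⁻¹' (f ⁻¹' {Fin.last N})) ≤ ε := by
      rw [measureReal_def, ← Measure.map_apply measurable_fst (hfm (measurableSet_singleton _)), hΨ.1]
      exact ENNReal.toReal_le_of_le_ofReal hε.le hfl.le
    have h3 : Ψ.real (Prod.snd ⁻¹' (g ⁻¹' {Fin.last N'})) ≤ ε := by
      rw [measureReal_def, ← Measure.map_apply measurable_snd (hgm (measurableSet_singleton _)), hΨ.2]
      exact ENNReal.toReal_le_of_le_ofReal hε.le hgl.le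
    have h4 := measureReal_union_le (μ := Ψ) (thetaExcess c μ ν D')
      (Prod.fst ⁻¹' (f ⁻¹' {Fin.last N}) ∪ Prod.snd ⁻¹' (g ⁻¹' {Fin.last N'}))
    have h5 := measureReal_union_le (μ := Ψ) (Prod.fst ⁻¹' (f ⁻¹' {Fin.last N}))
      (Prod.snd ⁻¹' (g ⁻¹' {Fin.last N'}))
    linarith
  filter_upwards [eventually_gt_atTop 0,
    (tendsto_deficit μ hfm hfr).eventually (gt_mem_nhds hε),
    (tendsto_deficit ν hgm hgr).eventually (gt_mem_nhds hε),
    eventually_exists_perm_avgCost_le hQ hmin (fun x y => (hS x y).2)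
      (max (max M₁ M₂) 0) D] with n hn hdef₁ hdef₂ hperm
  obtain ⟨π, hπ, hπh⟩ := exists_table_of_index_maps hψ hψ1
    (P := fun u => (Measure.pi fun _ : Fin n => μ).real {u})
    (R := fun v => (Measure.pi fun _ : Fin n => ν).real {v}) (fun _ => measureReal_nonneg)
    (by rw [sum_measureReal_singleton]; simp) (fun _ => measureReal_nonneg)
    (by rw [sum_measureReal_singleton]; simp)
    (fun u => f (WithLp.toLp 2 (fluctuation (fun a => μ.real {a}) u)))
    (fun v => g (WithLp.toLp 2 (fluctuation (fun b => ν.real {b}) v)))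
  have hπb := hπh (fun i j => if (i, j) ∈ goodᶜ then (1 : ℝ) else 0)
    (fun i j => by split_ifs <;> norm_num) (fun i j => by split_ifs <;> norm_num)
  refine (productExcessProb_le_of_mem_couplings c _ μ ν (tableMeasure_mem_couplings hπ)).trans ?_
  rw [tableMeasure_apply, Fintype.sum_prod_type]
  -- Pairs of positive mass contain no null letters, so their fluctuations are admissible. In a good
  -- cell they are bounded and within `δ` of a witness with `θ ≤ D'`, hence carry a signed coupling
  -- of cost at most `D`, and a cheap matching exists.
  have hterm : ∀ (u : Fin n → A) (v : Fin n → B),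
      (if (u, v) ∈ {z : (Fin n → A) × (Fin n → B) | ∀ τ : Equiv.Perm (Fin n),
        (otCost c μ ν).toReal + D / √(n : ℝ) < avgCost c n z.1 (z.2 ∘ τ)} then
          ENNReal.ofReal (π u v) else 0) ≤
      ENNReal.ofReal (π u v * if (f (WithLp.toLp 2 (fluctuation (fun a => μ.real {a}) u)),
        g (WithLp.toLp 2 (fluctuation (fun b => ν.real {b}) v))) ∈ goodᶜ then 1 else 0) := by
    intro u v
    by_cases hz : π u v = 0
    · simp [hz]
    split_ifs with hcost hbad
    · rw [mul_one]
    · exfalso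
      have hu : (Measure.pi fun _ : Fin n => μ).real {u} ≠ 0 := fun h => hz (by
        have := hπ.2.1 u
        dsimp only at this
        rw [h, Finset.sum_eq_zero_iff_of_nonneg fun b _ => hπ.1 u b] at this
        exact this v (Finset.mem_univ v))
      have hv : (Measure.pi fun _ : Fin n => ν).real {v} ≠ 0 := fun h => hz (by
        have := hπ.2.2 v
        dsimp only at this
        rw [h, Finset.sum_eq_zero_iff_of_nonneg fun a _ => hπ.1 a v] at this
        exact this u (Finset.mem_univ u))
      have hu' := (fluctuation_mem_perturbations_iff hn hp1 u).2
        (ne_zero_of_pi_real_singleton_pos hu)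
      have hv' := (fluctuation_mem_perturbations_iff hn hq1 v).2
        (ne_zero_of_pi_real_singleton_pos hv)
      simp only [Set.mem_compl_iff, not_not] at hbad
      obtain ⟨hl₁, hl₂, e, e', hfe, hge, hpe, hpe', hθ⟩ := hbad
      obtain ⟨β, hβ, hβc⟩ := (theta_le_iff c μ ν _ _ D').1 hθ
      obtain ⟨β', hβ', hβc'⟩ := hK _ hpe _ hu' _ hpe' _ hv' β hβ
      have hd₁ := hfd _ _ hfe.symm hl₁
      have hd₂ := hgd _ _ hge.symm hl₂
      have hnorm : ‖(fluctuation (fun a => μ.real {a}) u - (fun a => e a),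
          fluctuation (fun b => ν.real {b}) v - fun b => e' b)‖ ≤ δ := by
        refine norm_prod_le_iff.2 ⟨norm_toLp_le hδ.le ?_, norm_toLp_le hδ.le ?_⟩
        · rw [dist_eq_norm] at hd₁; exact hd₁
        · rw [dist_eq_norm] at hd₂; exact hd₂
      obtain ⟨τ, hτ⟩ := hperm u v (norm_prod_le_iff.2
        ⟨norm_toLp_le (le_max_right _ _) ((hM₁ _ hl₁).trans ((le_max_left _ _).trans (le_max_left _ _))),
          norm_toLp_le (le_max_right _ _)
            ((hM₂ _ hl₂).trans ((le_max_right _ _).trans (le_max_left _ _)))⟩)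
        ⟨β', hβ', hβc'.trans (by
          have := mul_le_mul_of_nonneg_left hnorm hK0
          linarith)⟩
      have := hcost τ
      rw [hα] at this
      exact absurd hτ (not_le.2 this)
    · exact zero_le
    · exact zero_le
  refine (Finset.sum_le_sum fun u _ => Finset.sum_le_sum fun v _ => hterm u v).trans ?_
  have hnn : ∀ u v, 0 ≤ π u v * if (f (WithLp.toLp 2 (fluctuation (fun a => μ.real {a}) u)),
        g (WithLp.toLp 2 (fluctuation (fun b => ν.real {b}) v))) ∈ goodᶜ then (1 : ℝ) else 0 :=
    fun u v => mul_nonneg (hπ.1 u v) (by split_ifs <;> norm_num)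
  simp only [← ENNReal.ofReal_sum_of_nonneg fun v _ => hnn _ v]
  rw [← ENNReal.ofReal_sum_of_nonneg fun u _ => Finset.sum_nonneg fun v _ => hnn u v]
  rw [← ofReal_measureReal (μ := Ψ) (s := thetaExcess c μ ν D'),
    ← ENNReal.ofReal_add measureReal_nonneg (by linarith)]
  -- The error `4 * ε` consists of two last cells and two deficits.
  refine ENNReal.ofReal_le_ofReal (hπb.trans ?_)
  linarith

theorem limsup_productExcessProb_le_Lam {D D' : ℝ} (hD : D' < D) :
    limsup (fun n : ℕ => productExcessProb c n ((otCost c μ ν).toReal + D / √(n : ℝ)) μ ν) atTop ≤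
      Lam c μ ν D' := by
  refine le_iInf₂ fun Ψ hΨ => ENNReal.le_of_forall_pos_le_add fun ε hε _ => ?_
  refine limsup_le_of_le (by isBoundedDefault) ?_
  filter_upwards [eventually_productExcessProb_le c μ ν hD hΨ
    (ε := (ε : ℝ) / 4) (by have : (0 : ℝ) < ε := hε; linarith)] with n hn
  refine hn.trans (add_le_add le_rfl (le_of_eq ?_))
  rw [mul_div_cancel₀ _ (by norm_num), ENNReal.ofReal_coe_nnreal]

end UpperBound

end StrassenOT

/-! ### The main theorem -/

open StrassenOT in
theorem theorem4 {𝒳 𝒴 : Type*}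
    [Fintype 𝒳] [DecidableEq 𝒳] [MeasurableSpace 𝒳] [MeasurableSingletonClass 𝒳]
    [Fintype 𝒴] [DecidableEq 𝒴] [MeasurableSpace 𝒴] [MeasurableSingletonClass 𝒴]
    (PX : Measure 𝒳) [IsProbabilityMeasure PX] (PY : Measure 𝒴) [IsProbabilityMeasure PY]
    (c : 𝒳 → 𝒴 → ℝ≥0) (α : ℝ) (hα : α = (otCost c PX PY).toReal) :
    (∀ Δ : ℝ,
      Lam c PX PY Δ ≤
        liminf (fun n : ℕ => productExcessProb c n (α + Δ / √(n : ℝ)) PX PY) atTop ∧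
      liminf (fun n : ℕ => productExcessProb c n (α + Δ / √(n : ℝ)) PX PY) atTop ≤
        limsup (fun n : ℕ => productExcessProb c n (α + Δ / √(n : ℝ)) PX PY) atTop ∧
      ∃ L : ℝ≥0∞, Tendsto (fun Δ' : ℝ => Lam c PX PY Δ') (𝓝[<] Δ) (𝓝 L) ∧
        limsup (fun n : ℕ => productExcessProb c n (α + Δ / √(n : ℝ)) PX PY) atTop ≤ L) ∧
    (∀ Δ : ℝ, ContinuousWithinAt (fun Δ' : ℝ => Lam c PX PY Δ') (Set.Ici Δ) Δ) ∧
    (∀ᵐ Δ : ℝ, Tendsto (fun n : ℕ => productExcessProb c n (α + Δ / √(n : ℝ)) PX PY)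
      atTop (𝓝 (Lam c PX PY Δ))) := by
  subst hα
  have hanti := Lam_antitone c PX PY
  have hlim : ∀ Δ : ℝ, Tendsto (fun Δ' : ℝ => Lam c PX PY Δ') (𝓝[<] Δ)
      (𝓝 (sInf (Lam c PX PY '' Set.Iio Δ))) := fun Δ => hanti.tendsto_nhdsLT Δ
  have hupper : ∀ Δ : ℝ, limsup (fun n : ℕ => productExcessProb c n
      ((otCost c PX PY).toReal + Δ / √(n : ℝ)) PX PY) atTop ≤
        sInf (Lam c PX PY '' Set.Iio Δ) := by
    intro Δ
    refine le_sInf ?_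
    rintro _ ⟨Δ', hΔ', rfl⟩
    exact limsup_productExcessProb_le_Lam c PX PY hΔ'
  refine ⟨fun Δ => ⟨Lam_le_liminf c PX PY Δ, liminf_le_limsup, _, hlim Δ, hupper Δ⟩,
    continuousWithinAt_Lam c PX PY, ?_⟩
  -- A monotone function has countably many discontinuities; elsewhere the left limit is the value,
  -- and the two bounds coincide.
  filter_upwards [hanti.countable_not_continuousAt.ae_notMem volume] with Δ hΔ
  have hcont : ContinuousAt (Lam c PX PY) Δ := not_not.1 hΔ
  have heq : sInf (Lam c PX PY '' Set.Iio Δ) = Lam c PX PY Δ :=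
    tendsto_nhds_unique (hlim Δ) (hcont.tendsto.mono_left nhdsWithin_le_nhds)
  exact tendsto_of_le_liminf_of_limsup_le (Lam_le_liminf c PX PY Δ) (heq ▸ hupper Δ)
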